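/- Let $d\ge 4$ be an even integer, $\Omega_d=\begin{pmatrix}0&I_{d/2}\\-I_{d/2}&0\end{pmatrix}$, and $Sp(d)=\{S\in U(d): S^{\top}\Omega_d S=\Omega_d\}$. A linear map $\mathcal L:M_d(\mathbb C)\to M_d(\mathbb C)$ is called $(S,S)$-covariant if $\mathcal L(SZS^*)=S\mathcal L(Z)S^*$ for all $S\in Sp(d)$ and $Z\in M_d(\mathbb C)$; it is $k$-positive if $\mathrm{id}_k\otimes\mathcal L$ maps positive semidefinite matrices in $M_k(\mathbb C)\otimes M_d(\mathbb C)$ to positive semidefinite matrices, completely positive if it is $k$-positive for all $k\ge1$, completely copositive if $\top\circ\mathcal L$ is completely positive ($\top$ the transposition), and decomposable if it is the sum of a completely positive and a completely copositive linear map. For $p,q\in\mathbb R$ put $$\mathcal L_{p,q}(Z)=(1-p-q)\frac{\mathrm{Tr}(Z)}{d}I_d+pZ+q\,\Omega_dZ^{\top}\Omega_d^*,\qquad \mathbb P_k=\{(p,q)\in\mathbb R^2:\mathcal L_{p,q}\text{ is }k\text{-positive}\},$$ $$\mathbb D=\Big\{(p,q)\in\mathbb R^2: -\tfrac{2+d}{d^2-d-2}\le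 p+q\le 1,\ p+(1-d)q\le 1,\ (1-d)p+q\le 1\Big\}.$$ Every $\mathcal L_{p,q}$ is $(S,S)$-covariant, and $\mathcal L_{p,q}$ is decomposable if and only if $(p,q)\in\mathbb D$. Moreover: 1. $\mathbb P_k\setminus\mathbb D\neq\emptyset$ for every $k=1,\dots,\frac d2-1$, whereas $\mathbb P_{d/2}\subseteq\mathbb D$. 2. $$\mathbb P_{d/2-1}\setminus\mathbb D=\Big\{(p,q)\in\mathbb R^2: p+q<-\tfrac{2+d}{d^2-d-2},\ p+(1-d)q\le 1,\ \big(1-(\tfrac d2-1)d\big)p+q\le 1\Big\},$$ and $\mathcal L_{p,q}$ is $(\frac d2-1)$-positive and not decomposable if and only if $(p,q)$ lies in this set. 3. For $P=\big(-\frac{2}{d^2-3d},-\frac{d-2}{d^2-3d}\big)$ the map $$\mathcal L_P(Z)=\frac1{d^2-3d}\big((d-2)\mathrm{Tr}(Z)I_d-2Z-(d-2)\Omega_dZ^{\top}\Omega_d^*\big)$$ is $k$-positive for every $k=1,\dots,\frac d2-1$ and is not decomposable. 4. Every $\frac d2$-positive $(S,S)$-covariant linear map $M_d(\mathbb C)\to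 M_d(\mathbb C)$ is decomposable. -/

import Mathlib

open scoped ComplexOrder

namespace SympMaps

/-- The algebra `M_d(ℂ)`. -/
abbrev Mat (d : ℕ) : Type := Matrix (Fin d) (Fin d) ℂ

/-- The ampliation `id_k ⊗ L` of a linear map `L : M_d(ℂ) → M_d(ℂ)`, acting on
`M_k(ℂ) ⊗ M_d(ℂ)`, which is identified with the matrices indexed by `Fin k × Fin d`:
`L` is applied to each of the `k²` blocks of size `d × d`. -/
def ampliation {d : ℕ} (k : ℕ) (L : Mat d →ₗ[ℂ] Mat d)
    (X : Matrix (Fin k × Fin d) (Fin k × Fin d) ℂ) :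
    Matrix (Fin k × Fin d) (Fin k × Fin d) ℂ :=
  Matrix.of fun r s => L (Matrix.of fun a b => X (r.1, a) (s.1, b)) r.2 s.2

/-- `k`-positivity: `id_k ⊗ L` maps positive semidefinite matrices to positive semidefinite
matrices. -/
def IsKPositive {d : ℕ} (k : ℕ) (L : Mat d →ₗ[ℂ] Mat d) : Prop :=
  ∀ X : Matrix (Fin k × Fin d) (Fin k × Fin d) ℂ,
    X.PosSemidef → (ampliation k L X).PosSemidef

/-- Complete positivity. -/
def IsCP {d : ℕ} (L : Mat d →ₗ[ℂ] Mat d) : Prop :=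
  ∀ k : ℕ, 1 ≤ k → IsKPositive k L

/-- The transposition map on `M_d(ℂ)`. -/
def transposeMap (d : ℕ) : Mat d →ₗ[ℂ] Mat d :=
  (Matrix.transposeLinearEquiv (Fin d) (Fin d) ℂ ℂ).toLinearMap

/-- Complete copositivity: the transposition composed with `L` is completely positive. -/
def IsCoCP {d : ℕ} (L : Mat d →ₗ[ℂ] Mat d) : Prop :=
  IsCP (transposeMap d ∘ₗ L)

/-- Decomposability: `L` is the sum of a CP and a co-CP map. -/
def IsDecomposable {d : ℕ} (L : Mat d →ₗ[ℂ] Mat d) : Prop :=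
  ∃ L₁ L₂ : Mat d →ₗ[ℂ] Mat d, IsCP L₁ ∧ IsCoCP L₂ ∧ L = L₁ + L₂

/-- The standard symplectic matrix `Ω_d = [[0, I], [-I, 0]]` with blocks of size `d / 2`
(used for even `d`). -/
def Omega (d : ℕ) : Mat d :=
  Matrix.of fun i j =>
    if (i : ℕ) + d / 2 = (j : ℕ) then 1
    else if (j : ℕ) + d / 2 = (i : ℕ) then -1
    else 0

/-- The compact symplectic group `Sp(d) = {S ∈ U(d) : Sᵀ Ω_d S = Ω_d}`. -/
def Sp (d : ℕ) : Set (Mat d) :=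
  {S | S ∈ Matrix.unitaryGroup (Fin d) ℂ ∧ S.transpose * Omega d * S = Omega d}

/-- `(S,S)`-covariance: `L(S Z S*) = S L(Z) S*` for all `S ∈ Sp(d)`. -/
def IsSympCovariant {d : ℕ} (L : Mat d →ₗ[ℂ] Mat d) : Prop :=
  ∀ S ∈ Sp d, ∀ Z : Mat d,
    L (S * Z * S.conjTranspose) = S * L Z * S.conjTranspose

/-- The map `L_{p,q}(Z) = (1-p-q) (Tr Z / d) I + p Z + q Ω Zᵀ Ω*`. -/
noncomputable def sympMap (d : ℕ) (p q : ℝ) : Mat d →ₗ[ℂ] Mat d where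
  toFun Z := ((1 - (p : ℂ) - (q : ℂ)) * (Z.trace / (d : ℂ))) • (1 : Mat d)
    + (p : ℂ) • Z + (q : ℂ) • (Omega d * Z.transpose * (Omega d).conjTranspose)
  map_add' X Y := by
    simp only [Matrix.trace_add, Matrix.transpose_add, Matrix.add_mul,
      smul_add, add_div, mul_add, add_smul]
    abel
  map_smul' c X := by
    simp only [Matrix.trace_smul, Matrix.transpose_smul, Matrix.mul_smul, Matrix.smul_mul,
      smul_add, smul_smul, smul_eq_mul, RingHom.id_apply]
    congr 1
    · congr 1
      · congr 1
        ring
      · rw [mul_comm]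
    · rw [mul_comm]

/-- The `k`-positivity region of the family `L_{p,q}`. -/
def kPosRegion (d k : ℕ) : Set (ℝ × ℝ) :=
  {x | IsKPositive k (sympMap d x.1 x.2)}

/-- The quadrilateral `D`. -/
def decRegion (d : ℕ) : Set (ℝ × ℝ) :=
  {x | -((2 + (d : ℝ)) / ((d : ℝ) ^ 2 - d - 2)) ≤ x.1 + x.2 ∧ x.1 + x.2 ≤ 1 ∧
    x.1 + (1 - (d : ℝ)) * x.2 ≤ 1 ∧ (1 - (d : ℝ)) * x.1 + x.2 ≤ 1}

/-- The triangular parameter region of the `(d/2 - 1)`-positive indecomposable maps `L_{p,q}`. -/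
def indecTriangle (d : ℕ) : Set (ℝ × ℝ) :=
  {x | x.1 + x.2 < -((2 + (d : ℝ)) / ((d : ℝ) ^ 2 - d - 2)) ∧
    x.1 + (1 - (d : ℝ)) * x.2 ≤ 1 ∧
    (1 - ((d : ℝ) / 2 - 1) * d) * x.1 + x.2 ≤ 1}

/-- The point `P = (-2/(d²-3d), -(d-2)/(d²-3d))`. -/
noncomputable def pointP (d : ℕ) : ℝ × ℝ :=
  (-(2 / ((d : ℝ) ^ 2 - 3 * d)), -(((d : ℝ) - 2) / ((d : ℝ) ^ 2 - 3 * d)))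

end SympMaps

namespace SympMaps

/-! Write `σ(Z) = Ω Zᵀ Ω*` and consider `L(Z) = a Tr(Z) I + p Z + q σ(Z)`. Pairing `id_k ⊗ L` at a
rank one matrix `v v*` with `w` gives `a N + p T + q R`, where `A = ∑ vᵢ wᵢ*`, `N = ‖A‖²`, `T = |Tr
A|²` and `R = -⟨σ(A), A⟩`. As `A` has rank at most `k` and is otherwise arbitrary, `k`-positivity is
an inequality between three numbers attached to matrices of rank at most `k`
(`isKPositive_covMap_of_form`, `IsKPositive.form_nonneg`).

Cauchy-Schwarz gives `T ≤ k N`; applied to `A + σ(A)`, of rank at most `2k`, it gives `T ≤ k (N -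
R)`. For `q ≤ 0` these two bounds yield `k`-positivity when `a + q` and `a + k p` are nonnegative
(`isKPositive_covMap`). Conversely, matrix units and isotropic projections force `a`, `a + p`, `a +
q` and `a + k p` to be nonnegative.

Decomposability amounts to `a`, `a + p`, `a + q` and `p + q + a (1 + 2/d)` being nonnegative. An
explicit splitting proves sufficiency (`isDecomposable_covMap`). The first three conditions already
follow from positivity; the fourth comes from a functional which is nonnegative on both CP and co-CP
maps (`IsDecomposable.witness_nonneg`). A matrix of rank `d/2` shows that `d/2`-positivity forces
the same fourth inequality (`IsKPositive.add_nonneg_of_covMap`), whereas `(d/2 - 1)`-positivity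
leaves a triangle beyond it.

Finally, a covariant map is determined by its value at one diagonal matrix unit, which must commute
with a large stabilizer. So the three-parameter family is everything
(`eq_covMap_of_isSympCovariant`), and the statement for arbitrary covariant maps reduces to the
family. -/

open Matrix

variable {d : ℕ}

/-! ### The index pairing and the entries of the symplectic matrix. -/

/-- The index paired with `i` by the symplectic form. -/
def partner (i : Fin d) : Fin d := ⟨(i + d / 2) % d, Nat.mod_lt _ i.pos⟩

/-- The sign with which `i` enters the symplectic form. -/
def sgn (i : Fin d) : ℂ := if (i : ℕ) < d / 2 then 1 else -1

lemma partner_val_of_lt (hd : Even d) (i : Fin d) (h : (i : ℕ) < d / 2) :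
    (partner i : ℕ) = i + d / 2 := by
  obtain ⟨m, rfl⟩ := hd
  exact Nat.mod_eq_of_lt (by omega)

lemma partner_val_of_le (hd : Even d) (i : Fin d) (h : d / 2 ≤ (i : ℕ)) :
    (partner i : ℕ) = i - d / 2 := by
  obtain ⟨m, rfl⟩ := hd
  have := i.isLt
  have e : (i : ℕ) + (m + m) / 2 = (i - (m + m) / 2) + (m + m) := by omega
  simp only [partner]
  rw [e, Nat.add_mod_right, Nat.mod_eq_of_lt (by omega)]

@[simp] lemma partner_partner (hd : Even d) (i : Fin d) : partner (partner i) = i := by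
  have := i.isLt
  have h2 : d / 2 + d / 2 = d := by obtain ⟨m, rfl⟩ := hd; omega
  apply Fin.ext
  rcases lt_or_ge (i : ℕ) (d / 2) with h | h
  · have h1 := partner_val_of_lt hd i h
    rw [partner_val_of_le hd _ (by omega)]; omega
  · have h1 := partner_val_of_le hd i h
    rw [partner_val_of_lt hd _ (by omega)]; omega

lemma partner_ne (hd : Even d) (i : Fin d) : partner i ≠ i := by
  have := i.isLt
  have h2 : d / 2 + d / 2 = d := by obtain ⟨m, rfl⟩ := hd; omega
  intro e
  have e := congrArg Fin.val e
  rcases lt_or_ge (i : ℕ) (d / 2) with h | h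
  · rw [partner_val_of_lt hd i h] at e; omega
  · rw [partner_val_of_le hd i h] at e; omega

lemma sgn_partner (hd : Even d) (i : Fin d) : sgn (partner i) = -sgn i := by
  have := i.isLt
  have h2 : d / 2 + d / 2 = d := by obtain ⟨m, rfl⟩ := hd; omega
  unfold sgn
  rcases lt_or_ge (i : ℕ) (d / 2) with h | h
  · rw [partner_val_of_lt hd i h, if_neg (by omega), if_pos h]
  · rw [partner_val_of_le hd i h, if_pos (by omega), if_neg (by omega), neg_neg]

@[simp] lemma sgn_mul_self (i : Fin d) : sgn i * sgn i = 1 := by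
  unfold sgn; split_ifs <;> simp

@[simp] lemma star_sgn (i : Fin d) : star (sgn i) = sgn i := by
  unfold sgn; split_ifs <;> simp

/-- The pairing as a permutation. -/
def partnerEquiv (hd : Even d) : Equiv.Perm (Fin d) :=
  ⟨partner, partner, partner_partner hd, partner_partner hd⟩

@[simp] lemma partnerEquiv_apply (hd : Even d) (i : Fin d) : partnerEquiv hd i = partner i := rfl

lemma partner_eq_iff (hd : Even d) (i j : Fin d) : partner i = j ↔ i = partner j := by
  constructor <;> rintro rfl <;> simp [hd]

lemma partner_inj (hd : Even d) {i j : Fin d} : partner i = partner j ↔ i = j :=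
  (partnerEquiv hd).injective.eq_iff

lemma Omega_apply (hd : Even d) (i j : Fin d) :
    Omega d i j = if j = partner i then sgn i else 0 := by
  have := i.isLt
  have := j.isLt
  have h2 : d / 2 + d / 2 = d := by obtain ⟨m, rfl⟩ := hd; omega
  simp only [Omega, of_apply, sgn, Fin.ext_iff]
  rcases lt_or_ge (i : ℕ) (d / 2) with h | h
  · rw [partner_val_of_lt hd i h]
    split_ifs <;> first | rfl | omega
  · rw [partner_val_of_le hd i h]
    split_ifs <;> first | rfl | omega

lemma sum_ite_eq_partner (hd : Even d) (i : Fin d) (f : Fin d → ℂ) :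
    ∑ j, (if i = partner j then f j else 0) = f (partner i) := by
  simp [← partner_eq_iff hd]

lemma Omega_conj_apply (hd : Even d) (Z : Mat d) (i j : Fin d) :
    (Omega d * Z.transpose * (Omega d).conjTranspose) i j =
      sgn i * sgn j * Z (partner j) (partner i) := by
  simp only [mul_apply, Omega_apply hd, conjTranspose_apply, transpose_apply, ite_mul, zero_mul,
    Finset.sum_ite_eq', Finset.mem_univ, if_true, apply_ite (star : ℂ → ℂ), star_zero, star_sgn,
    mul_ite, mul_zero]
  ring

/-! ### Symplectic transposition and the covariant family. -/

/-- The involution `Z ↦ Ω Zᵀ Ω*`. -/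
noncomputable def symplTranspose (d : ℕ) : Mat d →ₗ[ℂ] Mat d where
  toFun Z := Omega d * Z.transpose * (Omega d).conjTranspose
  map_add' X Y := by simp [Matrix.mul_add, Matrix.add_mul]
  map_smul' c X := by simp

lemma symplTranspose_apply (hd : Even d) (Z : Mat d) (i j : Fin d) :
    symplTranspose d Z i j = sgn i * sgn j * Z (partner j) (partner i) :=
  Omega_conj_apply hd Z i j

/-- The unnormalized covariant map `Z ↦ a Tr(Z) I + p Z + q Ω Zᵀ Ω*`. -/
noncomputable def covMap (d : ℕ) (a p q : ℂ) : Mat d →ₗ[ℂ] Mat d :=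
  a • (traceLinearMap (Fin d) ℂ ℂ).smulRight (1 : Mat d) + p • LinearMap.id
    + q • symplTranspose d

lemma covMap_apply (a p q : ℂ) (Z : Mat d) :
    covMap d a p q Z = (a * Z.trace) • (1 : Mat d) + p • Z
      + q • (Omega d * Z.transpose * (Omega d).conjTranspose) := by
  simp [covMap, symplTranspose, smul_smul]

lemma covMap_apply_apply (hd : Even d) (a p q : ℂ) (Z : Mat d) (i j : Fin d) :
    covMap d a p q Z i j = a * Z.trace * (if i = j then 1 else 0) + p * Z i j
      + q * (sgn i * sgn j * Z (partner j) (partner i)) := by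
  simp [covMap_apply, Omega_conj_apply hd, one_apply]

lemma sympMap_eq_covMap (d : ℕ) (p q : ℝ) :
    sympMap d p q = covMap d (((1 - p - q) / d : ℝ) : ℂ) p q := by
  ext1 Z
  rw [covMap_apply]
  simp only [sympMap, LinearMap.coe_mk, AddHom.coe_mk]
  congr 3
  push_cast
  ring

lemma Omega_mul_Omega (hd : Even d) : Omega d * Omega d = -1 := by
  ext i j
  simp only [mul_apply, Omega_apply hd, ite_mul, zero_mul, Finset.sum_ite_eq', Finset.mem_univ,
    if_true, partner_partner hd, sgn_partner hd, Matrix.neg_apply, Matrix.one_apply]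
  by_cases h : i = j
  · simp [h]
  · simp [h, Ne.symm h]

/-- For unitary `S` the relation `SᵀΩS = Ω` becomes `Ω S̄ = S Ω`, so symplectic transposition
commutes with conjugation by `S`. -/
lemma isSympCovariant_covMap (hd : Even d) (a p q : ℂ) : IsSympCovariant (covMap d a p q) := by
  intro S hS Z
  obtain ⟨hU, hΩ⟩ := hS
  have h1 : Sᴴ * S = 1 := (Matrix.mem_unitaryGroup_iff').1 hU
  have h2 : S * Sᴴ = 1 := (Matrix.mem_unitaryGroup_iff).1 hU
  have hc : Sᴴᵀ * Sᵀ = 1 := by rw [← transpose_mul, h2, transpose_one]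
  have e0 : Omega d * S = Sᴴᵀ * Omega d := by
    calc Omega d * S = (Sᴴᵀ * Sᵀ) * (Omega d * S) := by rw [hc, Matrix.one_mul]
      _ = Sᴴᵀ * (Sᵀ * Omega d * S) := by simp only [Matrix.mul_assoc]
      _ = _ := by rw [hΩ]
  have hO := Omega_mul_Omega hd
  have e1 : Omega d * Sᴴᵀ = S * Omega d := by
    have : Omega d * (Omega d * S) * Omega d = Omega d * (Sᴴᵀ * Omega d) * Omega d := by rw [e0]
    rw [← Matrix.mul_assoc, hO, Matrix.mul_assoc, Matrix.mul_assoc, Matrix.mul_assoc, hO] at this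
    simpa using this.symm
  have e2 : Sᵀ * (Omega d)ᴴ = (Omega d)ᴴ * Sᴴ := by
    have := congrArg conjTranspose e1
    rw [conjTranspose_mul, conjTranspose_mul] at this
    rw [← this]
    congr 1
    ext i j; simp
  have e3 : (S * Z * Sᴴ).trace = Z.trace := by
    rw [Matrix.trace_mul_comm, ← Matrix.mul_assoc, h1, Matrix.one_mul]
  have e4 : Omega d * (S * Z * Sᴴ)ᵀ * (Omega d)ᴴ = S * (Omega d * Zᵀ * (Omega d)ᴴ) * Sᴴ := by
    rw [transpose_mul, transpose_mul]
    calc Omega d * (Sᴴᵀ * (Zᵀ * Sᵀ)) * (Omega d)ᴴ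
        = (Omega d * Sᴴᵀ) * Zᵀ * (Sᵀ * (Omega d)ᴴ) := by simp only [Matrix.mul_assoc]
      _ = _ := by rw [e1, e2]; simp only [Matrix.mul_assoc]
  rw [covMap_apply, covMap_apply, e3, e4]
  simp [Matrix.mul_add, Matrix.add_mul, h2]

/-! ### The quadratic form of the ampliations. -/

/-- The squared Hilbert-Schmidt norm. -/
noncomputable def hsSq (A : Mat d) : ℝ := ∑ i, ∑ j, ‖A i j‖ ^ 2

/-- The Hilbert-Schmidt pairing of `A` with minus its symplectic transpose. -/
noncomputable def symplForm (A : Mat d) : ℂ :=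
  ∑ i, ∑ j, sgn i * sgn j * A (partner j) i * star (A (partner i) j)

lemma ampliation_sum {ι : Type*} (s : Finset ι) (k : ℕ) (L : Mat d →ₗ[ℂ] Mat d)
    (X : ι → Matrix (Fin k × Fin d) (Fin k × Fin d) ℂ) :
    ampliation k L (∑ i ∈ s, X i) = ∑ i ∈ s, ampliation k L (X i) := by
  ext r t
  have : (of fun a b => (∑ i ∈ s, X i) (r.1, a) (t.1, b) : Mat d)
      = ∑ i ∈ s, of fun a b => X i (r.1, a) (t.1, b) := by
    ext a b; simp [Matrix.sum_apply]
  rw [ampliation, of_apply, this, map_sum, Matrix.sum_apply, Matrix.sum_apply]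
  rfl

lemma ampliation_add (k : ℕ) (L₁ L₂ : Mat d →ₗ[ℂ] Mat d)
    (X : Matrix (Fin k × Fin d) (Fin k × Fin d) ℂ) :
    ampliation k (L₁ + L₂) X = ampliation k L₁ X + ampliation k L₂ X := by
  ext r t; simp [ampliation]

lemma ampliation_smul (k : ℕ) (c : ℂ) (L : Mat d →ₗ[ℂ] Mat d)
    (X : Matrix (Fin k × Fin d) (Fin k × Fin d) ℂ) :
    ampliation k (c • L) X = c • ampliation k L X := by
  ext r t; simp [ampliation]

lemma IsKPositive.add {k : ℕ} {L₁ L₂ : Mat d →ₗ[ℂ] Mat d} (h₁ : IsKPositive k L₁)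
    (h₂ : IsKPositive k L₂) : IsKPositive k (L₁ + L₂) := fun X hX => by
  rw [ampliation_add]; exact (h₁ X hX).add (h₂ X hX)

lemma IsKPositive.smul {k : ℕ} {L : Mat d →ₗ[ℂ] Mat d} (h : IsKPositive k L) {c : ℝ}
    (hc : 0 ≤ c) : IsKPositive k ((c : ℂ) • L) := fun X hX => by
  rw [ampliation_smul]; exact (h X hX).smul (by exact_mod_cast hc)

/-- The matrix `∑ i, vᵢ wᵢ*` built from two vectors of `ℂ^k ⊗ ℂ^d`. -/
noncomputable def pairMat {k : ℕ} (v w : Fin k × Fin d → ℂ) : Mat d :=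
  of fun a b => ∑ i, v (i, a) * star (w (i, b))

lemma ofReal_hsSq (A : Mat d) : (hsSq A : ℂ) = ∑ i, ∑ j, A i j * star (A i j) := by
  simp [hsSq, Complex.mul_conj, Complex.normSq_eq_norm_sq]

/-- The quadratic form of the ampliation of a covariant map at a rank one matrix. -/
lemma dotProduct_ampliation_covMap (hd : Even d) (k : ℕ) (a p q : ℂ) (v w : Fin k × Fin d → ℂ) :
    star w ⬝ᵥ (ampliation k (covMap d a p q) (vecMulVec v (star v)) *ᵥ w) =
      a * hsSq (pairMat v w) + p * ((pairMat v w).trace * star (pairMat v w).trace)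
        + q * symplForm (pairMat v w) := by
  have e : star w ⬝ᵥ (ampliation k (covMap d a p q) (vecMulVec v (star v)) *ᵥ w) =
      a * (∑ i, ∑ x, ∑ j, ∑ y, star (w (i, x)) * ((∑ c, v (i, c) * star (v (j, c))) *
        (if x = y then 1 else 0)) * w (j, y))
      + p * (∑ i, ∑ x, ∑ j, ∑ y, star (w (i, x)) * (v (i, x) * star (v (j, y))) * w (j, y))
      + q * (∑ i, ∑ x, ∑ j, ∑ y, star (w (i, x)) * (sgn x * sgn y * (v (i, partner y) *
        star (v (j, partner x)))) * w (j, y)) := by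
    simp only [dotProduct, mulVec, Fintype.sum_prod_type, Finset.mul_sum, ampliation, of_apply,
      covMap_apply_apply hd, vecMulVec_apply, trace, diag_apply, Pi.star_apply,
      ← Finset.sum_add_distrib]
    refine Finset.sum_congr rfl fun i _ => Finset.sum_congr rfl fun x _ =>
      Finset.sum_congr rfl fun j _ => Finset.sum_congr rfl fun y _ => ?_
    simp only [← Finset.mul_sum]
    ring
  have e1 : (∑ i, ∑ x, ∑ j, ∑ y, star (w (i, x)) * ((∑ c, v (i, c) * star (v (j, c))) *
      (if x = y then 1 else 0)) * w (j, y)) = (hsSq (pairMat v w) : ℂ) := by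
    rw [ofReal_hsSq]
    simp only [pairMat, of_apply, star_sum, star_mul', star_star, mul_ite, mul_one, mul_zero,
      ite_mul, zero_mul, Finset.sum_ite_eq, Finset.mem_univ, if_true, Finset.sum_mul_sum]
    simp only [Finset.mul_sum, Finset.sum_mul]
    refine Finset.sum_comm.trans (Eq.trans ?_ Finset.sum_comm)
    refine Finset.sum_congr rfl fun x _ => Eq.trans ?_ Finset.sum_comm
    refine Finset.sum_congr rfl fun i _ => Finset.sum_comm.trans ?_
    refine Finset.sum_congr rfl fun c _ => Finset.sum_congr rfl fun j _ => ?_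
    ring
  have e2 : (∑ i, ∑ x, ∑ j, ∑ y, star (w (i, x)) * (v (i, x) * star (v (j, y))) * w (j, y)) =
      (pairMat v w).trace * star (pairMat v w).trace := by
    simp only [pairMat, of_apply, trace, diag_apply, star_sum, star_mul', star_star]
    rw [Finset.sum_comm (s := (Finset.univ : Finset (Fin d))),
      Finset.sum_comm (s := (Finset.univ : Finset (Fin d)))]
    simp only [Finset.sum_mul]
    simp only [Finset.mul_sum]
    refine Finset.sum_congr rfl fun i _ => Finset.sum_congr rfl fun x _ =>
      Finset.sum_congr rfl fun j _ => Finset.sum_congr rfl fun y _ => ?_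
    ring
  have e3 : (∑ i, ∑ x, ∑ j, ∑ y, star (w (i, x)) * (sgn x * sgn y * (v (i, partner y) *
      star (v (j, partner x)))) * w (j, y)) = symplForm (pairMat v w) := by
    simp only [symplForm, pairMat, of_apply, star_sum, star_mul', star_star]
    simp only [Finset.mul_sum, Finset.sum_mul]
    rw [Finset.sum_comm]
    refine Finset.sum_congr rfl fun x _ => ?_
    refine (Finset.sum_congr rfl fun i _ => Finset.sum_comm).trans ?_
    rw [Finset.sum_comm]
    refine Finset.sum_congr rfl fun y _ => ?_
    rw [Finset.sum_comm]
    refine Finset.sum_congr rfl fun j _ => Finset.sum_congr rfl fun i _ => ?_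
    ring
  rw [e, e1, e2, e3]

lemma star_symplForm (A : Mat d) : star (symplForm A) = symplForm A := by
  simp only [symplForm, star_sum, star_mul', star_star, star_sgn]
  rw [Finset.sum_comm]
  refine Finset.sum_congr rfl fun i _ => Finset.sum_congr rfl fun j _ => ?_
  ring

lemma ofReal_re_symplForm (A : Mat d) : ((symplForm A).re : ℂ) = symplForm A :=
  Complex.conj_eq_iff_re.1 (star_symplForm A)

lemma form_eq_ofReal (a p q : ℝ) (A : Mat d) :
    (a : ℂ) * hsSq A + p * (A.trace * star A.trace) + q * symplForm A =
      ((a * hsSq A + p * ‖A.trace‖ ^ 2 + q * (symplForm A).re : ℝ) : ℂ) := by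
  push_cast
  rw [ofReal_re_symplForm]
  simp [Complex.mul_conj, Complex.normSq_eq_norm_sq]

lemma ampliation_covMap_isHermitian (hd : Even d) (k : ℕ) (a p q : ℝ)
    {X : Matrix (Fin k × Fin d) (Fin k × Fin d) ℂ} (hX : X.IsHermitian) :
    (ampliation k (covMap d a p q) X).IsHermitian := by
  have key : ∀ r s, ampliation k (covMap d a p q) X r s =
      a * (∑ c, X (r.1, c) (s.1, c)) * (if r.2 = s.2 then 1 else 0) + p * X r s
        + q * (sgn r.2 * sgn s.2 * X (r.1, partner s.2) (s.1, partner r.2)) :=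
    fun r s => covMap_apply_apply hd _ _ _ _ _ _
  have h : ∀ x y, star (X x y) = X y x := fun x y => hX.apply y x
  ext r s
  rw [conjTranspose_apply, key, key]
  simp only [star_add, star_mul', star_sum, star_sgn, h, apply_ite (star : ℂ → ℂ), star_one,
    star_zero, eq_comm (a := s.2)]
  simp only [Complex.star_def, Complex.conj_ofReal]
  ring

/-- A positive semidefinite matrix is a sum of rank one terms and the ampliation is additive, so
rank one inputs suffice. -/
lemma isKPositive_covMap_of_form (hd : Even d) {k : ℕ} {a p q : ℝ}
    (h : ∀ v w : Fin k × Fin d → ℂ, 0 ≤ a * hsSq (pairMat v w) + p * ‖(pairMat v w).trace‖ ^ 2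
      + q * (symplForm (pairMat v w)).re) :
    IsKPositive k (covMap d a p q) := by
  intro X hX
  obtain ⟨n, v, hv⟩ := Matrix.posSemidef_iff_eq_sum_vecMulVec.1 hX
  refine .of_dotProduct_mulVec_nonneg (ampliation_covMap_isHermitian hd k a p q hX.1) fun w => ?_
  rw [hv, ampliation_sum, Matrix.sum_mulVec, dotProduct_sum]
  refine Finset.sum_nonneg fun i _ => ?_
  rw [dotProduct_ampliation_covMap hd, form_eq_ofReal]
  exact_mod_cast h _ _

lemma IsKPositive.form_nonneg (hd : Even d) {k : ℕ} {a p q : ℝ}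
    (h : IsKPositive k (covMap d a p q)) (v w : Fin k × Fin d → ℂ) :
    0 ≤ a * hsSq (pairMat v w) + p * ‖(pairMat v w).trace‖ ^ 2
      + q * (symplForm (pairMat v w)).re := by
  have := (h _ (Matrix.posSemidef_vecMulVec_self_star v)).dotProduct_mulVec_nonneg w
  rw [dotProduct_ampliation_covMap hd, form_eq_ofReal] at this
  exact_mod_cast this

/-! ### Trace inequalities for matrices of bounded rank. -/

lemma hsSq_nonneg (A : Mat d) : 0 ≤ hsSq A :=
  Finset.sum_nonneg fun _ _ => Finset.sum_nonneg fun _ _ => by positivity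

lemma trace_symplTranspose (hd : Even d) (A : Mat d) : (symplTranspose d A).trace = A.trace := by
  simp only [trace, diag_apply, symplTranspose_apply hd, sgn_mul_self, one_mul]
  exact Equiv.sum_comp (partnerEquiv hd) (fun i => A i i)

lemma symplForm_eq (hd : Even d) (A : Mat d) :
    symplForm A = -∑ i, ∑ j, symplTranspose d A i j * star (A i j) := by
  rw [symplForm, ← Equiv.sum_comp (partnerEquiv hd), ← Finset.sum_neg_distrib]
  refine Finset.sum_congr rfl fun i _ => ?_
  rw [← Finset.sum_neg_distrib]
  refine Finset.sum_congr rfl fun j _ => ?_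
  simp only [partnerEquiv_apply, partner_partner hd, sgn_partner hd, symplTranspose_apply hd]
  ring

lemma hsSq_symplTranspose (hd : Even d) (A : Mat d) : hsSq (symplTranspose d A) = hsSq A := by
  have h1 : ∀ i : Fin d, ‖sgn i‖ = 1 := fun i => by unfold sgn; split_ifs <;> simp
  simp only [hsSq, symplTranspose_apply hd, norm_mul, h1, one_mul]
  refine (Equiv.sum_comp (partnerEquiv hd) (fun i => ∑ j, ‖A (partner j) i‖ ^ 2)).trans ?_
  refine Finset.sum_comm.trans ?_
  exact Equiv.sum_comp (partnerEquiv hd) (fun j => ∑ i, ‖A j i‖ ^ 2)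

/-- Symplectic transposition is an isometry, and the cross term is `-symplForm A` by definition of
the form. -/
lemma hsSq_add_symplTranspose (hd : Even d) (A : Mat d) :
    hsSq (A + symplTranspose d A) = 2 * hsSq A - 2 * (symplForm A).re := by
  have h : hsSq (A + symplTranspose d A) = hsSq A + hsSq (symplTranspose d A)
      + 2 * (∑ i, ∑ j, symplTranspose d A i j * star (A i j)).re := by
    simp only [hsSq, Complex.re_sum, Finset.mul_sum, ← Finset.sum_add_distrib]
    refine Finset.sum_congr rfl fun i _ => Finset.sum_congr rfl fun j _ => ?_
    simp only [Matrix.add_apply, ← Complex.normSq_eq_norm_sq, Complex.normSq_add]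
    rw [← Complex.conj_re]
    simp [mul_comm]
  rw [h, hsSq_symplTranspose hd, symplForm_eq hd, Complex.neg_re]
  ring

/-- Cauchy-Schwarz for the trace: `|Tr A|² ≤ rank(A) ‖A‖²`. -/
lemma norm_trace_sq_le (A : Mat d) {r : ℕ} (K : Submodule ℂ (EuclideanSpace ℂ (Fin d)))
    (hK : Module.finrank ℂ K ≤ r) (hA : ∀ j, WithLp.toLp 2 (fun i => A i j) ∈ K) :
    ‖A.trace‖ ^ 2 ≤ r * hsSq A := by
  set n := Module.finrank ℂ K
  let b : OrthonormalBasis (Fin n) ℂ K := stdOrthonormalBasis ℂ K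
  let c : Fin n → Fin d → ℂ := fun l j =>
    inner ℂ ((b l : K) : EuclideanSpace ℂ (Fin d)) (WithLp.toLp 2 (fun i => A i j))
  -- Expanding the columns in an orthonormal basis of `K` writes the trace as one inner product over
  -- `Fin n × Fin d`; the basis factor has squared norm `n`, the coefficient factor `hsSq A`.
  have hAc : ∀ i j, A i j = ∑ l, c l j * (b l : EuclideanSpace ℂ (Fin d)) i := by
    intro i j
    have := congrArg (fun x : K => (x : EuclideanSpace ℂ (Fin d)) i) (b.sum_repr' ⟨_, hA j⟩)
    simpa [c] using this.symm
  have hc : hsSq A = ∑ l, ∑ j, ‖c l j‖ ^ 2 := by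
    rw [hsSq, Finset.sum_comm, Finset.sum_comm (s := (Finset.univ : Finset (Fin n)))]
    refine Finset.sum_congr rfl fun j _ => ?_
    have h1 := b.sum_sq_norm_inner_right ⟨_, hA j⟩
    rw [Submodule.coe_norm, EuclideanSpace.norm_sq_eq] at h1
    exact h1.symm
  have ht : A.trace = ∑ l, ∑ j, c l j * (b l : EuclideanSpace ℂ (Fin d)) j := by
    rw [Finset.sum_comm]
    exact Finset.sum_congr rfl fun j _ => hAc j j
  have hb : ∑ l, ∑ j, ‖(b l : EuclideanSpace ℂ (Fin d)) j‖ ^ 2 = n := by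
    have : ∀ l, ∑ j, ‖(b l : EuclideanSpace ℂ (Fin d)) j‖ ^ 2 = 1 := fun l => by
      rw [← EuclideanSpace.norm_sq_eq]
      have := b.norm_eq_one l
      rw [← Submodule.coe_norm, this]; norm_num
    simp [this]
  have h1 : ‖A.trace‖ ≤ ∑ x : Fin n × Fin d,
      ‖c x.1 x.2‖ * ‖(b x.1 : EuclideanSpace ℂ (Fin d)) x.2‖ := by
    rw [ht, ← Fintype.sum_prod_type']
    exact (norm_sum_le _ _).trans_eq (by simp only [norm_mul])
  have h2 := Finset.sum_mul_sq_le_sq_mul_sq (Finset.univ : Finset (Fin n × Fin d))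
    (fun x => ‖c x.1 x.2‖) (fun x => ‖(b x.1 : EuclideanSpace ℂ (Fin d)) x.2‖)
  rw [Fintype.sum_prod_type' (f := fun l j => ‖c l j‖ ^ 2),
    Fintype.sum_prod_type' (f := fun l j => ‖(b l : EuclideanSpace ℂ (Fin d)) j‖ ^ 2),
    ← hc, hb] at h2
  calc ‖A.trace‖ ^ 2 ≤ _ := pow_le_pow_left₀ (norm_nonneg _) h1 2
    _ ≤ hsSq A * n := h2
    _ ≤ hsSq A * r := mul_le_mul_of_nonneg_left (by exact_mod_cast hK) (hsSq_nonneg A)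
    _ = r * hsSq A := mul_comm _ _

lemma norm_trace_sq_le_of_span {ι : Type*} [Fintype ι] (A : Mat d)
    (x : ι → EuclideanSpace ℂ (Fin d))
    (hA : ∀ j, WithLp.toLp 2 (fun i => A i j) ∈ Submodule.span ℂ (Set.range x)) :
    ‖A.trace‖ ^ 2 ≤ Fintype.card ι * hsSq A :=
  norm_trace_sq_le A _ (finrank_range_le_card x) hA

lemma norm_trace_pairMat_sq_le {k : ℕ} (v w : Fin k × Fin d → ℂ) :
    ‖(pairMat v w).trace‖ ^ 2 ≤ k * hsSq (pairMat v w) := by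
  have := norm_trace_sq_le_of_span (pairMat v w) (fun i : Fin k => WithLp.toLp 2 fun a => v (i, a))
    fun j => by
      have : WithLp.toLp 2 (fun i => pairMat v w i j) =
          ∑ i, star (w (i, j)) • (WithLp.toLp 2 fun a => v (i, a) : EuclideanSpace ℂ (Fin d)) := by
        ext a; simp [pairMat, mul_comm]
      rw [this]
      exact Submodule.sum_mem _ fun i _ => Submodule.smul_mem _ _ (Submodule.subset_span ⟨i, rfl⟩)
  simpa using this

lemma trace_add_symplTranspose (hd : Even d) (A : Mat d) :
    ‖(A + symplTranspose d A).trace‖ ^ 2 = 4 * ‖A.trace‖ ^ 2 := by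
  rw [trace_add, trace_symplTranspose hd, ← two_mul, norm_mul, mul_pow]
  norm_num

/-- The columns of `A + σ(A)` lie in the span of the `2k` vectors `vᵢ` and `Ω w̄ᵢ`, and its trace is
`2 Tr A`. The factor `4` on the left thus cancels against the `2k` and the `2 (N - R)` on the right.
-/
lemma norm_trace_pairMat_sq_le' (hd : Even d) {k : ℕ} (v w : Fin k × Fin d → ℂ) :
    ‖(pairMat v w).trace‖ ^ 2 ≤
      k * (hsSq (pairMat v w) - (symplForm (pairMat v w)).re) := by
  have := norm_trace_sq_le_of_span (pairMat v w + symplTranspose d (pairMat v w))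
    (Sum.elim (fun i : Fin k => WithLp.toLp 2 fun a => v (i, a))
      (fun i : Fin k => WithLp.toLp 2 fun a => sgn a * star (w (i, partner a))))
    fun j => by
      have : WithLp.toLp 2 (fun i => (pairMat v w + symplTranspose d (pairMat v w)) i j) =
          ∑ i, star (w (i, j)) • (WithLp.toLp 2 fun a => v (i, a) : EuclideanSpace ℂ (Fin d))
          + ∑ i, (sgn j * v (i, partner j)) • (WithLp.toLp 2
            fun a => sgn a * star (w (i, partner a)) : EuclideanSpace ℂ (Fin d)) := by
        ext a
        simp only [Matrix.add_apply, symplTranspose_apply hd, pairMat, of_apply, Finset.mul_sum,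
          PiLp.add_apply, WithLp.ofLp_sum, Finset.sum_apply, PiLp.smul_apply, smul_eq_mul]
        congr 1
        · exact Finset.sum_congr rfl fun i _ => mul_comm _ _
        · exact Finset.sum_congr rfl fun i _ => by ring
      rw [this]
      exact add_mem (Submodule.sum_mem _ fun i _ => Submodule.smul_mem _ _
          (Submodule.subset_span ⟨Sum.inl i, rfl⟩))
        (Submodule.sum_mem _ fun i _ => Submodule.smul_mem _ _
          (Submodule.subset_span ⟨Sum.inr i, rfl⟩))
  rw [trace_add_symplTranspose hd, hsSq_add_symplTranspose hd, Fintype.card_sum,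
    Fintype.card_fin] at this
  push_cast at this
  linarith

lemma norm_trace_sq_le_dim (hd : Even d) (A : Mat d) :
    2 * ‖A.trace‖ ^ 2 ≤ d * (hsSq A - (symplForm A).re) := by
  have := norm_trace_sq_le (A + symplTranspose d A) ⊤ (r := d) (by simp) (by simp)
  rw [trace_add_symplTranspose hd, hsSq_add_symplTranspose hd] at this
  linarith

/-! ### Sufficient conditions for positivity and decomposability. -/

/-- A sufficient condition for `k`-positivity. -/
lemma isKPositive_covMap (hd : Even d) {k n : ℕ} (hn : 0 < n) (hkn : k ≤ n) {a p q : ℝ} (hq : q ≤ 0)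
    (haq : 0 ≤ a + q) (hap : 0 ≤ a + n * p) : IsKPositive k (covMap d a p q) := by
  refine isKPositive_covMap_of_form hd fun v w => ?_
  have h1 := norm_trace_pairMat_sq_le v w
  have h2 := norm_trace_pairMat_sq_le' hd v w
  have h0 := hsSq_nonneg (pairMat v w)
  set N := hsSq (pairMat v w)
  set R := (symplForm (pairMat v w)).re
  set T := ‖(pairMat v w).trace‖ ^ 2
  have hT : 0 ≤ T := by positivity
  have hk : (k : ℝ) ≤ n := by exact_mod_cast hkn
  have hn' : (0 : ℝ) < n := by exact_mod_cast hn
  have hM : 0 ≤ N - R := by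
    have := hsSq_nonneg (pairMat v w + symplTranspose d (pairMat v w))
    rw [hsSq_add_symplTranspose hd] at this
    linarith
  have h1' : T ≤ n * N := h1.trans (mul_le_mul_of_nonneg_right hk h0)
  have h2' : T ≤ n * (N - R) := h2.trans (mul_le_mul_of_nonneg_right hk hM)
  have e1 := mul_le_mul_of_nonneg_left h1' haq
  have e2 := mul_le_mul_of_nonneg_left h2' (neg_nonneg.2 hq)
  have e3 := mul_nonneg hap hT
  -- The right side is `(a + q) n N + (-q) n (N - R) + n p T`, which the two trace bounds push above
  -- `(a + n p) T`.
  have : 0 ≤ n * (a * N + p * T + q * R) := by nlinarith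
  exact nonneg_of_mul_nonneg_right this hn'

/-- The form is `(u/2)(N - R) - (u/d) T + x T`, and `2T ≤ d (N - R)` holds without any rank bound.
-/
lemma isCP_covMap (hd : Even d) (h0 : 0 < d) {u x : ℝ} (hu : 0 ≤ u) (hx : 0 ≤ x) :
    IsCP (covMap d (u / 2 : ℝ) (x - u / d : ℝ) (-(u / 2) : ℝ)) := by
  intro k _
  refine isKPositive_covMap_of_form hd fun v w => ?_
  have h1 := norm_trace_sq_le_dim hd (pairMat v w)
  have hd' : (0 : ℝ) < d := by exact_mod_cast h0
  set N := hsSq (pairMat v w)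
  set R := (symplForm (pairMat v w)).re
  set T := ‖(pairMat v w).trace‖ ^ 2
  have hT : 0 ≤ T := by positivity
  have e1 : 0 ≤ (u / (2 * d)) * (d * (N - R) - 2 * T) := mul_nonneg (by positivity) (by linarith)
  have e2 : (u / (2 * d)) * (d * (N - R) - 2 * T) = u / 2 * (N - R) - u / d * T := by
    field_simp
  have e3 := mul_nonneg hx hT
  nlinarith

/-- Symplectic transposition is an involution fixing the identity matrix, so it only exchanges the
last two terms. -/
lemma symplTranspose_comp_covMap (hd : Even d) (a p q : ℂ) :
    symplTranspose d ∘ₗ covMap d a p q = covMap d a q p := by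
  ext1 Z
  ext i j
  rw [LinearMap.comp_apply, symplTranspose_apply hd, covMap_apply_apply hd, covMap_apply_apply hd]
  have hi := sgn_mul_self i
  have hj := sgn_mul_self j
  simp only [partner_partner hd, sgn_partner hd, partner_inj hd, eq_comm (a := j)]
  by_cases h : i = j
  · subst h
    simp only [if_true]
    linear_combination (a * Z.trace + q * Z i i * (sgn i * sgn i + 1)) * hi
  · simp only [h, if_false]
    linear_combination (q * Z i j * sgn j * sgn j) * hi + q * Z i j * hj

/-- Transposition after symplectic transposition is conjugation by a signed permutation matrix,
which preserves complete positivity. -/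
lemma isCoCP_symplTranspose_comp (hd : Even d) {L : Mat d →ₗ[ℂ] Mat d} (hL : IsCP L) :
    IsCoCP (symplTranspose d ∘ₗ L) := by
  intro k hk X hX
  have h := ((hL k hk X hX).submatrix
    (fun r : Fin k × Fin d => (r.1, partner r.2))).conjTranspose_mul_mul_same
      (diagonal fun r => sgn r.2)
  convert h using 1
  ext r s
  simp only [diagonal_conjTranspose, diagonal_mul, mul_diagonal,
    submatrix_apply, Pi.star_apply, star_sgn]
  refine (symplTranspose_apply hd _ s.2 r.2).trans ?_
  simp only [ampliation, of_apply]
  ring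

lemma covMap_add_covMap (a p q a' p' q' : ℂ) :
    covMap d a p q + covMap d a' p' q' = covMap d (a + a') (p + p') (q + q') := by
  simp only [covMap, add_smul]
  abel

/-- Decomposability of the covariant maps in the cone over the quadrilateral. -/
lemma isDecomposable_covMap (hd : Even d) (h4 : 4 ≤ d) {a p q : ℝ} (ha : 0 ≤ a)
    (hap : 0 ≤ a + p) (haq : 0 ≤ a + q) (h : 0 ≤ p + q + a * (1 + 2 / d)) :
    IsDecomposable (covMap d a p q) := by
  have hd' : (4 : ℝ) ≤ d := by exact_mod_cast h4
  have hd0 : (0 : ℝ) < d := by linarith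
  set e : ℝ := 1 / d with he
  have he0 : 0 < e := by positivity
  have he4 : e ≤ 1 / 4 := one_div_le_one_div_of_le (by norm_num) hd'
  have h2 : (2 : ℝ) / d = 2 * e := by rw [he]; ring
  rw [h2] at h
  have hc : 0 < 1 / 2 - e := by linarith
  -- The parameter `u` goes to the CP part and `2a - u` to the co-CP part; the last two bounds say
  -- that the leftover coefficients of `Z` and `σ(Z)` are nonnegative. The four hypotheses are
  -- exactly what makes these bounds compatible.
  obtain ⟨u, hu0, hu1, hu2, hu3⟩ : ∃ u : ℝ, 0 ≤ u ∧ u ≤ 2 * a ∧ u * (1 / 2 - e) ≤ p + a ∧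
      -(q + 2 * a * e) ≤ u * (1 / 2 - e) := by
    rcases le_total 0 (q + 2 * a * e) with h' | h'
    · exact ⟨0, le_rfl, by linarith, by linarith, by linarith⟩
    · refine ⟨-(q + 2 * a * e) / (1 / 2 - e), div_nonneg (by linarith) hc.le, ?_, ?_, ?_⟩
      · rw [div_le_iff₀ hc]; nlinarith
      · rw [div_mul_cancel₀ _ hc.ne']; nlinarith
      · rw [div_mul_cancel₀ _ hc.ne']
  have hx : 0 ≤ p + u * e + (2 * a - u) / 2 := by nlinarith
  have hy : 0 ≤ q + u / 2 + (2 * a - u) * e := by nlinarith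
  have hv : 0 ≤ 2 * a - u := by linarith
  refine ⟨_, _, isCP_covMap hd (by omega) hu0 hx,
    isCoCP_symplTranspose_comp hd (isCP_covMap hd (by omega) hv hy), ?_⟩
  rw [symplTranspose_comp_covMap hd, covMap_add_covMap]
  have e1 : u / d = u * e := by rw [he]; ring
  have e2 : (2 * a - u) / d = (2 * a - u) * e := by rw [he]; ring
  rw [e1, e2, ← Complex.ofReal_add, ← Complex.ofReal_add, ← Complex.ofReal_add]
  congr 2 <;> ring

/-! ### Necessary conditions for decomposability -/

lemma posSemidef_sum_nonneg {n ι : Type*} [Fintype n] [Fintype ι] {C : Matrix n n ℂ}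
    (hC : C.PosSemidef) (f : ι → n) (c : ι → ℂ) :
    0 ≤ ∑ i, ∑ j, star (c i) * c j * C (f i) (f j) := by
  have := (hC.submatrix f).dotProduct_mulVec_nonneg c
  simp only [dotProduct, mulVec, Finset.mul_sum, submatrix_apply, Pi.star_apply] at this
  refine this.trans_eq (Finset.sum_congr rfl fun i _ => Finset.sum_congr rfl fun j _ => ?_)
  ring

lemma nonneg_of_two_mul_nonneg {z : ℂ} (h : 0 ≤ 2 * z) : 0 ≤ z := by
  simpa [Complex.le_def, eq_comm] using h

/-- The Choi matrix. -/
noncomputable def choi (L : Mat d →ₗ[ℂ] Mat d) : Matrix (Fin d × Fin d) (Fin d × Fin d) ℂ :=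
  of fun r s => L (single r.1 s.1 1) r.2 s.2

lemma IsCP.choi_posSemidef (h0 : 0 < d) {L : Mat d →ₗ[ℂ] Mat d} (hL : IsCP L) :
    (choi L).PosSemidef := by
  have h := hL d h0 _ (Matrix.posSemidef_vecMulVec_self_star
    (fun r : Fin d × Fin d => if r.1 = r.2 then (1 : ℂ) else 0))
  convert h using 1
  ext r s
  simp only [choi, ampliation, of_apply]
  refine congrArg (fun Z : Mat d => L Z r.2 s.2) ?_
  ext a b
  simp [vecMulVec_apply, single_apply, ← ite_and, and_comm]

/-- The functional detecting indecomposability. -/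
noncomputable def witness (L : Mat d →ₗ[ℂ] Mat d) : ℂ :=
  (∑ a, ∑ b, L (single a b 1) a b) + (∑ a, ∑ b, L (single a a 1) b b) +
    ∑ a, ∑ b, sgn a * sgn b * L (single a b 1) (partner b) (partner a)

/-- The first sum is the Choi matrix evaluated at `∑ e_a ⊗ e_a`. The other two add up to half the
sum of its values at the vectors `sgn a e_a ⊗ e_{b'} + sgn b e_b ⊗ e_{a'}`, with primes for
partners. -/
lemma witness_nonneg_of_isCP (hd : Even d) (h0 : 0 < d) {L : Mat d →ₗ[ℂ] Mat d} (hL : IsCP L) :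
    0 ≤ witness L := by
  have hC := hL.choi_posSemidef h0
  have h1 := posSemidef_sum_nonneg hC (fun a : Fin d => (a, a)) (fun _ => 1)
  have h2 : 0 ≤ ∑ a, ∑ b, (choi L (a, partner b) (a, partner b) +
      choi L (b, partner a) (b, partner a) + sgn a * sgn b * choi L (a, partner b) (b, partner a)
      + sgn a * sgn b * choi L (b, partner a) (a, partner b)) := by
    refine Finset.sum_nonneg fun a _ => Finset.sum_nonneg fun b _ => ?_
    have := posSemidef_sum_nonneg hC ![(a, partner b), (b, partner a)] ![sgn a, sgn b]
    simp only [Fin.sum_univ_two, cons_val_zero, cons_val_one, star_sgn, sgn_mul_self, one_mul]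
      at this
    convert this using 1
    ring
  have e2 : ∑ a, ∑ b, (choi L (a, partner b) (a, partner b) +
      choi L (b, partner a) (b, partner a) + sgn a * sgn b * choi L (a, partner b) (b, partner a)
      + sgn a * sgn b * choi L (b, partner a) (a, partner b)) =
      2 * ((∑ a, ∑ b, choi L (a, b) (a, b)) +
        ∑ a, ∑ b, sgn a * sgn b * choi L (a, partner b) (b, partner a)) := by
    simp only [Finset.sum_add_distrib]
    have i1 : ∑ a, ∑ b, choi L (a, partner b) (a, partner b) = ∑ a, ∑ b, choi L (a, b) (a, b) :=
      Finset.sum_congr rfl fun a _ =>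
        Equiv.sum_comp (partnerEquiv hd) (fun b => choi L (a, b) (a, b))
    have i2 : ∑ a, ∑ b, choi L (b, partner a) (b, partner a) = ∑ a, ∑ b, choi L (a, b) (a, b) :=
      Finset.sum_comm.trans i1
    have i3 : ∑ a, ∑ b, sgn a * sgn b * choi L (b, partner a) (a, partner b) =
        ∑ a, ∑ b, sgn a * sgn b * choi L (a, partner b) (b, partner a) := by
      rw [Finset.sum_comm]
      exact Finset.sum_congr rfl fun a _ => Finset.sum_congr rfl fun b _ => by ring
    rw [i1, i2, i3]
    ring
  rw [e2] at h2
  have h3 := nonneg_of_two_mul_nonneg h2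
  have := add_nonneg h1 h3
  simpa [witness, choi, add_assoc] using this

/-- With the Choi matrix of the transposed map the roles change: the third sum is its value at `∑
sgn a e_a ⊗ e_{a'}`, and the first two give half the sum of its values at `e_a ⊗ e_b + e_b ⊗ e_a`.
-/
lemma witness_nonneg_of_isCoCP (h0 : 0 < d) {L : Mat d →ₗ[ℂ] Mat d}
    (hL : IsCoCP L) : 0 ≤ witness L := by
  have hC := IsCP.choi_posSemidef h0 hL
  set C := choi (transposeMap d ∘ₗ L) with hCdef
  have hCL : ∀ a b x y, L (single a b 1) x y = C (a, y) (b, x) := fun a b x y => rfl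
  have h1 := posSemidef_sum_nonneg hC (fun a : Fin d => (a, partner a)) sgn
  have h2 : 0 ≤ ∑ a, ∑ b, (C (a, b) (a, b) + C (b, a) (b, a) + C (a, b) (b, a)
      + C (b, a) (a, b)) := by
    refine Finset.sum_nonneg fun a _ => Finset.sum_nonneg fun b _ => ?_
    have := posSemidef_sum_nonneg hC ![(a, b), (b, a)] ![1, 1]
    simp only [Fin.sum_univ_two, cons_val_zero, cons_val_one, star_one, one_mul] at this
    convert this using 1
    ring
  have e2 : ∑ a, ∑ b, (C (a, b) (a, b) + C (b, a) (b, a) + C (a, b) (b, a) + C (b, a) (a, b)) =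
      2 * ((∑ a, ∑ b, C (a, b) (b, a)) + ∑ a, ∑ b, C (a, b) (a, b)) := by
    simp only [Finset.sum_add_distrib]
    have i2 : ∑ a, ∑ b, C (b, a) (b, a) = ∑ a, ∑ b, C (a, b) (a, b) := Finset.sum_comm
    have i3 : ∑ a, ∑ b, C (b, a) (a, b) = ∑ a, ∑ b, C (a, b) (b, a) := Finset.sum_comm
    rw [i2, i3]
    ring
  rw [e2] at h2
  have h3 := nonneg_of_two_mul_nonneg h2
  have := add_nonneg h3 h1
  simpa [witness, hCL] using this

lemma covMap_single_apply (hd : Even d) (A P Q : ℂ) (a b x y : Fin d) :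
    covMap d A P Q (single a b 1) x y = A * (if a = b then if x = y then 1 else 0 else 0) +
      P * (if a = x then if b = y then 1 else 0 else 0) +
      Q * (sgn x * sgn y * if a = partner y then if b = partner x then 1 else 0 else 0) := by
  rw [covMap_apply_apply hd]
  by_cases h : a = b
  · subst h; simp [single_apply, ite_and]
  · simp [single_apply, ite_and, trace_single_eq_of_ne _ _ _ h, h]

lemma witness_covMap (hd : Even d) (A P Q : ℂ) :
    witness (covMap d A P Q) = A * (d ^ 2 + 2 * d) + (P + Q) * d ^ 2 := by
  have hs : ∀ a : Fin d, ∑ b : Fin d, sgn a * sgn b *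
      (if a = partner b then if b = partner a then (1 : ℂ) else 0 else 0) = -1 := fun a => by
    rw [Finset.sum_eq_single (partner a) (fun b _ hb => by simp [hb]) (by simp)]
    simp [sgn_partner hd, hd]
  have s1 : ∑ a, ∑ b, covMap d A P Q (single a b 1) a b = A * d + P * d ^ 2 - Q * d := by
    simp only [covMap_single_apply hd, Finset.sum_add_distrib, ← Finset.mul_sum, hs]
    simp
    ring
  have s2 : ∑ a, ∑ b, covMap d A P Q (single a a 1) b b = A * d ^ 2 + P * d + Q * d := by
    simp only [covMap_single_apply hd, Finset.sum_add_distrib, ← Finset.mul_sum]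
    simp only [← ite_and, and_self, sgn_mul_self, one_mul, sum_ite_eq_partner hd]
    simp
    exact Or.inl (by ring)
  have s3 : ∑ a, ∑ b, sgn a * sgn b * covMap d A P Q (single a b 1) (partner b) (partner a) =
      A * d - P * d + Q * d ^ 2 := by
    have : ∀ a b : Fin d, sgn a * sgn b *
        covMap d A P Q (single a b 1) (partner b) (partner a) =
        A * (if a = b then 1 else 0) + P * (sgn a * sgn b *
          (if a = partner b then if b = partner a then (1 : ℂ) else 0 else 0)) + Q := by
      intro a b
      rw [covMap_single_apply hd]
      have ha := sgn_mul_self a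
      have hb := sgn_mul_self b
      simp only [partner_partner hd, sgn_partner hd, partner_inj hd, if_true]
      have e : sgn a * sgn b * (A * if a = b then if b = a then (1 : ℂ) else 0 else 0) =
          A * if a = b then 1 else 0 := by
        by_cases h : a = b
        · subst h; simp
        · simp [h]
      rw [mul_add, mul_add, e]
      linear_combination (Q * sgn b * sgn b) * ha + Q * hb
    simp only [this, Finset.sum_add_distrib, ← Finset.mul_sum, hs]
    simp
    ring
  rw [witness, s1, s2, s3]
  ring

lemma IsCoCP.isKPositive_one {L : Mat d →ₗ[ℂ] Mat d} (hL : IsCoCP L) : IsKPositive 1 L := by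
  intro X hX
  have := (hL 1 le_rfl X hX).transpose
  have e : ampliation 1 L X = (ampliation 1 (transposeMap d ∘ₗ L) X)ᵀ := by
    ext ⟨r, i⟩ ⟨s, j⟩
    obtain rfl := Subsingleton.elim r s
    rfl
  rwa [e]

lemma IsDecomposable.isKPositive_one {L : Mat d →ₗ[ℂ] Mat d} (hL : IsDecomposable L) :
    IsKPositive 1 L := by
  obtain ⟨L₁, L₂, h₁, h₂, rfl⟩ := hL
  exact (h₁ 1 le_rfl).add h₂.isKPositive_one

lemma witness_add (L₁ L₂ : Mat d →ₗ[ℂ] Mat d) :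
    witness (L₁ + L₂) = witness L₁ + witness L₂ := by
  simp only [witness, LinearMap.add_apply, Matrix.add_apply, mul_add, Finset.sum_add_distrib]
  ring

lemma IsDecomposable.witness_nonneg (hd : Even d) (h0 : 0 < d) {L : Mat d →ₗ[ℂ] Mat d}
    (hL : IsDecomposable L) : 0 ≤ witness L := by
  obtain ⟨L₁, L₂, h₁, h₂, rfl⟩ := hL
  rw [witness_add]
  exact add_nonneg (witness_nonneg_of_isCP hd h0 h₁) (witness_nonneg_of_isCoCP h0 h₂)

lemma IsDecomposable.add_nonneg_of_covMap (hd : Even d) (h0 : 0 < d) {a p q : ℝ}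
    (h : IsDecomposable (covMap d a p q)) : 0 ≤ p + q + a * (1 + 2 / d) := by
  have h1 := h.witness_nonneg hd h0
  rw [witness_covMap hd] at h1
  have h2 : 0 ≤ a * (d ^ 2 + 2 * d) + (p + q) * (d : ℝ) ^ 2 := by exact_mod_cast h1
  have hd' : (0 : ℝ) < d := by exact_mod_cast h0
  have e : a * (d ^ 2 + 2 * d) + (p + q) * (d : ℝ) ^ 2 =
      (d : ℝ) ^ 2 * (p + q + a * (1 + 2 / d)) := by field_simp; ring
  rw [e] at h2
  exact nonneg_of_mul_nonneg_right h2 (by positivity)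

/-! ### Necessary conditions for `k`-positivity -/

lemma pairMat_single {k : ℕ} (i : Fin k) (x y : Fin d) :
    pairMat (Pi.single (i, x) 1) (Pi.single (i, y) 1) = single x y (1 : ℂ) := by
  ext a b
  simp only [pairMat, of_apply]
  rw [Finset.sum_eq_single i (fun j _ hj => by simp [hj]) (by simp)]
  simp [Pi.single_apply, single_apply, ← ite_and, eq_comm, and_comm]

lemma hsSq_single (x y : Fin d) : hsSq (single x y (1 : ℂ)) = 1 := by
  simp only [hsSq, single_apply]
  rw [Finset.sum_eq_single x (fun j _ hj => by simp [Ne.symm hj]) (by simp),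
    Finset.sum_eq_single y (fun j _ hj => by simp [Ne.symm hj]) (by simp)]
  simp

lemma symplForm_single (x y : Fin d) :
    symplForm (single x y (1 : ℂ)) = if x = partner y then 1 else 0 := by
  simp only [symplForm, single_apply]
  rw [Finset.sum_eq_single y (fun j _ hj => by simp [Ne.symm hj]) (by simp),
    Finset.sum_eq_single y (fun j _ hj => by simp [Ne.symm hj]) (by simp)]
  split_ifs <;> simp_all

/-- Tests on the rank one matrix units `E_{xy}` with `x`, `y` distinct and unpaired, equal, or
paired; `4 ≤ d` supplies an unpaired couple. -/
lemma IsKPositive.nonneg_of_covMap (hd : Even d) (h4 : 4 ≤ d) {k : ℕ} (hk : 0 < k) {a p q : ℝ}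
    (h : IsKPositive k (covMap d a p q)) : 0 ≤ a ∧ 0 ≤ a + p ∧ 0 ≤ a + q := by
  have key := fun x y => h.form_nonneg hd (Pi.single (⟨0, hk⟩, x) 1) (Pi.single (⟨0, hk⟩, y) 1)
  simp only [pairMat_single, hsSq_single, symplForm_single] at key
  let i0 : Fin d := ⟨0, by omega⟩
  let i1 : Fin d := ⟨1, by omega⟩
  have h01 : i0 ≠ i1 := by simp [i0, i1]
  have h1 : partner i1 ≠ i0 := by
    have := partner_val_of_lt hd i1 (show 1 < d / 2 by omega)
    intro e
    rw [e] at this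
    simp only [i0, i1] at this
    omega
  have k1 := key i0 i1
  have k2 := key i0 i0
  have k3 := key i0 (partner i0)
  simp [trace_single_eq_of_ne _ _ _ h01, Ne.symm h1] at k1
  simp [(partner_ne hd i0).symm] at k2
  simp [trace_single_eq_of_ne _ _ _ (partner_ne hd i0).symm, hd] at k3
  exact ⟨k1, k2, k3⟩

/-- Taking `vᵢ = eᵢ` realizes any matrix supported on the first `k` rows, which supplies the test
matrices below. -/
lemma pairMat_of_rows {k : ℕ} (h : k ≤ d) (W : Fin d → Fin d → ℂ) (a b : Fin d) :
    pairMat (fun x : Fin k × Fin d => if (x.1 : ℕ) = x.2 then 1 else 0)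
      (fun x => W (Fin.castLE h x.1) x.2) a b = if (a : ℕ) < k then star (W a b) else 0 := by
  simp only [pairMat, of_apply]
  split_ifs with ha
  · rw [Finset.sum_eq_single ⟨a, ha⟩ (fun j _ hj => by
      rw [if_neg (fun e => hj (Fin.ext e)), zero_mul]) (by simp)]
    simp
  · refine Finset.sum_eq_zero fun i _ => ?_
    rw [if_neg (by have := i.isLt; omega), zero_mul]

lemma sum_ite_lt {R : Type*} [Semiring R] {k : ℕ} (h : k ≤ d) (c : R) :
    ∑ i : Fin d, (if (i : ℕ) < k then c else 0) = k * c := by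
  rw [← Finset.sum_filter, Finset.sum_const, Fin.card_filter_val_lt, min_eq_right h, nsmul_eq_mul]

/-- The condition coming from isotropic projections. -/
lemma IsKPositive.add_mul_nonneg_of_covMap (hd : Even d) {k : ℕ} (hk : 0 < k) (hkd : k ≤ d / 2)
    {a p q : ℝ} (h : IsKPositive k (covMap d a p q)) : 0 ≤ a + k * p := by
  have hkd' : k ≤ d := by omega
  have key := h.form_nonneg hd (fun x : Fin k × Fin d => if (x.1 : ℕ) = x.2 then 1 else 0)
    (fun x => (fun i j => if i = j then 1 else 0) (Fin.castLE hkd' x.1) x.2)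
  have hA := pairMat_of_rows hkd' (fun i j : Fin d => if i = j then (1 : ℂ) else 0)
  set A := pairMat (fun x : Fin k × Fin d => if (x.1 : ℕ) = x.2 then 1 else 0)
    (fun x => (fun i j => if i = j then (1 : ℂ) else 0) (Fin.castLE hkd' x.1) x.2)
  have hN : hsSq A = k := by
    rw [hsSq, ← mul_one (k : ℝ), ← sum_ite_lt hkd']
    refine Finset.sum_congr rfl fun i _ => ?_
    rw [Finset.sum_eq_single i (fun j _ hj => by simp [hA, Ne.symm hj]) (by simp), hA,
      if_pos rfl]
    split_ifs <;> simp
  have hT : A.trace = k := by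
    rw [trace, ← mul_one (k : ℂ), ← sum_ite_lt hkd']
    refine Finset.sum_congr rfl fun i _ => ?_
    simp [hA]
  -- Since `k ≤ d/2`, an index and its partner are never both below `k`.
  have hR : symplForm A = 0 := by
    refine Finset.sum_eq_zero fun i _ => Finset.sum_eq_zero fun j _ => ?_
    rw [hA, hA]
    by_cases e : partner j = i
    · subst e
      rw [partner_partner hd]
      rcases lt_or_ge (j : ℕ) (d / 2) with h | h
      · have := partner_val_of_lt hd j h
        rw [if_neg (by omega)]; simp
      · rw [if_neg (c := (j : ℕ) < k) (by omega)]; simp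
    · simp [e]
  rw [hN, hT, hR] at key
  have hk' : (0 : ℝ) < k := by exact_mod_cast hk
  simp only [Complex.norm_natCast, Complex.zero_re, mul_zero, add_zero] at key
  have : 0 ≤ (k : ℝ) * (a + k * p) := by linarith
  exact nonneg_of_mul_nonneg_right this hk'

/-- The condition coming from a matrix of rank `d / 2`. -/
lemma IsKPositive.add_nonneg_of_covMap (hd : Even d) (h0 : 0 < d)
    {a p q : ℝ} (h : IsKPositive (d / 2) (covMap d a p q)) : 0 ≤ p + q + a * (1 + 2 / d) := by
  have hdr : (0 : ℝ) < d := by exact_mod_cast h0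
  have h2 : d / 2 + d / 2 = d := by obtain ⟨m, rfl⟩ := hd; omega
  have hm : ((d / 2 : ℕ) : ℝ) = d / 2 := by
    have : ((d / 2 : ℕ) : ℝ) + (d / 2 : ℕ) = d := by exact_mod_cast h2
    linarith
  have hkd' : d / 2 ≤ d := by omega
  -- With diagonal entries `2` the squared trace is `d²`; this `n`, placed at the partner entries,
  -- makes `symplForm A` equal to `d²` too, so `p` and `q` enter with equal weight.
  set n : ℝ := √(2 * d)
  have hn : n ^ 2 = 2 * d := Real.sq_sqrt (by positivity)
  let W : Fin d → Fin d → ℂ := fun i j =>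
    (if i = j then 2 else 0) + (if j = partner i then (n : ℂ) else 0)
  have key := h.form_nonneg hd (fun x : Fin (d / 2) × Fin d => if (x.1 : ℕ) = x.2 then 1 else 0)
    (fun x => W (Fin.castLE hkd' x.1) x.2)
  have hA := pairMat_of_rows hkd' W
  set A := pairMat (fun x : Fin (d / 2) × Fin d => if (x.1 : ℕ) = x.2 then 1 else 0)
    (fun x => W (Fin.castLE hkd' x.1) x.2)
  have hN : hsSq A = (d / 2 : ℕ) * (4 + 2 * d) := by
    rw [hsSq, ← sum_ite_lt hkd']
    refine Finset.sum_congr rfl fun i _ => ?_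
    simp only [hA]
    split_ifs with hi
    · have : ∀ j, ‖star (W i j)‖ ^ 2 =
          (if i = j then 4 else 0) + (if j = partner i then n ^ 2 else 0) := by
        intro j
        rw [norm_star]
        by_cases e : i = j
        · subst e; simp [W, (partner_ne hd i).symm]; norm_num
        · by_cases e' : j = partner i <;> simp [W, e, e', (partner_ne hd i).symm]
      simp only [this, Finset.sum_add_distrib]
      simp [hn]
    · simp
  have hT : A.trace = d := by
    have : (d : ℂ) = (d / 2 : ℕ) * 2 := by rw [mul_two]; exact_mod_cast h2.symm
    rw [trace, this, ← sum_ite_lt hkd']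
    refine Finset.sum_congr rfl fun i _ => ?_
    simp [hA, W, (partner_ne hd i).symm]
  have hR : symplForm A = (d / 2 : ℕ) * (n : ℂ) ^ 2 := by
    rw [symplForm, ← sum_ite_lt hkd', ← Equiv.sum_comp (partnerEquiv hd)]
    refine Finset.sum_congr rfl fun i _ => ?_
    rw [Finset.sum_eq_single (partner i)]
    · rw [partnerEquiv_apply, partner_partner hd, sgn_mul_self, hA]
      split_ifs
      · simp [W, (partner_ne hd i).symm]; ring
      · simp
    · intro j _ hj
      rw [partnerEquiv_apply, hA, hA, partner_partner hd]
      by_cases e : i = j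
      · subst e
        rcases lt_or_ge (i : ℕ) (d / 2) with h | h
        · have := partner_val_of_lt hd i h
          rw [if_neg (by omega)]; simp
        · rw [if_neg (c := (i : ℕ) < d / 2) (by omega)]; simp
      · simp [W, e, hj]
    · simp
  have hR' : (symplForm A).re = (d / 2 : ℕ) * n ^ 2 := by
    rw [hR]; norm_cast
  rw [hN, hT, hR', hn, hm] at key
  simp only [Complex.norm_natCast] at key
  have e : a * ((d : ℝ) / 2 * (4 + 2 * d)) + p * d ^ 2 + q * (d / 2 * (2 * d)) =
      (d : ℝ) ^ 2 * (p + q + a * (1 + 2 / d)) := by field_simp; ring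
  rw [e] at key
  exact nonneg_of_mul_nonneg_right key (by positivity)

/-! ### Classification of the covariant maps -/

/-- The symplectic unitary with eigenvector `x` and eigenvalue `t`, and with eigenvector `Ω x̄` and
eigenvalue `t̄`, which fixes the orthogonal complement. -/
noncomputable def symplRot (x : Fin d → ℂ) (t : ℂ) : Mat d :=
  1 + (t - 1) • vecMulVec x (star x) +
    (star t - 1) • vecMulVec (Omega d *ᵥ star x) (star (Omega d *ᵥ star x))

lemma Omega_mulVec_apply (hd : Even d) (x : Fin d → ℂ) (i : Fin d) :
    (Omega d *ᵥ x) i = sgn i * x (partner i) := by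
  simp [mulVec, dotProduct, Omega_apply hd]

lemma symplRot_apply (hd : Even d) (x : Fin d → ℂ) (t : ℂ) (i j : Fin d) :
    symplRot x t i j = (if i = j then 1 else 0) + (t - 1) * (x i * star (x j)) +
      (star t - 1) * (sgn i * sgn j * star (x (partner i)) * x (partner j)) := by
  simp only [symplRot, Matrix.add_apply, Matrix.smul_apply, vecMulVec_apply, Pi.star_apply,
    Omega_mulVec_apply hd, star_mul', star_star, star_sgn, smul_eq_mul, one_apply]
  ring

lemma conjTranspose_symplRot (x : Fin d → ℂ) (t : ℂ) :
    (symplRot x t)ᴴ = symplRot x (star t) := by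
  simp [symplRot, conjTranspose_vecMulVec]

lemma symplRot_mul_symplRot (hd : Even d) {x : Fin d → ℂ} (hx : star x ⬝ᵥ x = 1) {t : ℂ}
    (ht : t * star t = 1) : symplRot x t * symplRot x (star t) = 1 := by
  set y := Omega d *ᵥ star x with hy
  -- Antisymmetry of `Ω`: reindexing by the pairing changes the sign. So `x` and `Ω x̄` are
  -- orthonormal and their projections multiply to zero.
  have h1 : star x ⬝ᵥ y = 0 := by
    have : star x ⬝ᵥ y = -(star x ⬝ᵥ y) := by
      conv_lhs => rw [hy, dotProduct, ← Equiv.sum_comp (partnerEquiv hd)]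
      rw [dotProduct, ← Finset.sum_neg_distrib]
      refine Finset.sum_congr rfl fun i _ => ?_
      simp only [partnerEquiv_apply, hy, Omega_mulVec_apply hd, partner_partner hd, sgn_partner hd]
      ring
    exact self_eq_neg.1 this
  have h2 : star y ⬝ᵥ x = 0 := by
    have := congrArg star h1
    rwa [star_dotProduct, star_zero, star_star] at this
  have h3 : star y ⬝ᵥ y = 1 := by
    rw [← hx, dotProduct, dotProduct, ← Equiv.sum_comp (partnerEquiv hd)]
    refine Finset.sum_congr rfl fun i _ => ?_
    simp only [partnerEquiv_apply, hy, Pi.star_apply, Omega_mulVec_apply hd, partner_partner hd,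
      star_mul', star_sgn, star_star]
    linear_combination (x i * star (x i)) * sgn_mul_self (partner i)
  have hxx : vecMulVec x (star x) * vecMulVec x (star x) = vecMulVec x (star x) := by
    rw [vecMulVec_mul_vecMulVec, hx, one_smul]
  have hxy : vecMulVec x (star x) * vecMulVec y (star y) = 0 := by
    rw [vecMulVec_mul_vecMulVec, h1]; simp
  have hyx : vecMulVec y (star y) * vecMulVec x (star x) = 0 := by
    rw [vecMulVec_mul_vecMulVec, h2]; simp
  have hyy : vecMulVec y (star y) * vecMulVec y (star y) = vecMulVec y (star y) := by
    rw [vecMulVec_mul_vecMulVec, h3, one_smul]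
  rw [symplRot, symplRot, ← hy, star_star]
  simp only [Matrix.mul_add, Matrix.add_mul, Matrix.mul_one, Matrix.one_mul, Matrix.smul_mul,
    Matrix.mul_smul, hxx, hxy, hyx, hyy, smul_zero, add_zero]
  match_scalars <;> first | ring1 | linear_combination ht

lemma symplRot_mem_Sp (hd : Even d) {x : Fin d → ℂ} (hx : star x ⬝ᵥ x = 1) {t : ℂ}
    (ht : t * star t = 1) : symplRot x t ∈ Sp d := by
  have hU : symplRot x t * symplRot x (star t) = 1 := symplRot_mul_symplRot hd hx ht
  have hU' : symplRot x (star t) * symplRot x t = 1 := by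
    have := symplRot_mul_symplRot hd hx (t := star t) (by rw [star_star, mul_comm, ht])
    rwa [star_star] at this
  refine ⟨mem_unitaryGroup_iff.2 ?_, ?_⟩
  · rwa [star_eq_conjTranspose, conjTranspose_symplRot]
  -- Symplectic transposition exchanges the projections onto `x` and `Ω x̄`, hence replaces `t` by
  -- its conjugate.
  · have e : (symplRot x t)ᵀ * Omega d = Omega d * symplRot x (star t) := by
      ext i j
      simp only [mul_apply, transpose_apply, Omega_apply hd, mul_ite, mul_zero, ite_mul, zero_mul,
        sum_ite_eq_partner hd, Finset.sum_ite_eq', Finset.mem_univ, if_true, symplRot_apply hd,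
        sgn_partner hd, partner_partner hd, star_star]
      have : (if partner j = i then (1 : ℂ) else 0) = if partner i = j then 1 else 0 := by
        simp only [partner_eq_iff hd j i, eq_comm]
      rw [this]
      have e : (if partner i = j then (1 : ℂ) else 0) * (sgn i + sgn j) = 0 := by
        split_ifs with h
        · rw [← h, sgn_partner hd]; ring
        · simp
      have hi := sgn_mul_self i
      have hj := sgn_mul_self j
      linear_combination -e + ((star t - 1) * sgn i * star (x j) * x (partner i)) * hj
        + ((t - 1) * sgn j * star (x i) * x (partner j)) * hi
    rw [e, Matrix.mul_assoc, hU', Matrix.mul_one]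

/-- The unit vector `(e_a + s e_b) / √2`. -/
noncomputable def pairVec (a b : Fin d) (s : ℂ) : Fin d → ℂ :=
  fun i => ((√2)⁻¹ : ℝ) * ((if i = a then 1 else 0) + s * (if i = b then 1 else 0))

lemma ofReal_inv_sqrt_two_mul_self : (((√2)⁻¹ : ℝ) : ℂ) * ((√2)⁻¹ : ℝ) = 1 / 2 := by
  rw [← Complex.ofReal_mul, ← mul_inv, Real.mul_self_sqrt (by norm_num)]
  norm_num

lemma pairVec_dotProduct {a b : Fin d} (hab : a ≠ b) {s : ℂ} (hs : s * star s = 1) :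
    star (pairVec a b s) ⬝ᵥ pairVec a b s = 1 := by
  have h : ∀ i, star (pairVec a b s) i * pairVec a b s i =
      1 / 2 * ((if i = a then 1 else 0) + (if i = b then 1 else 0)) := by
    intro i
    rw [← ofReal_inv_sqrt_two_mul_self]
    by_cases h1 : i = a
    · have h2 : i ≠ b := fun h2 => hab (h1.symm.trans h2)
      simp [pairVec, h1, hab]
    · by_cases h2 : i = b
      · simp only [Pi.star_apply, pairVec, h2, hab.symm, if_true, if_false, star_mul',
          star_add, star_zero, star_one, Complex.star_def, Complex.conj_ofReal] at hs ⊢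
        linear_combination ((((√2)⁻¹ : ℝ) : ℂ) * ((√2)⁻¹ : ℝ)) * hs
      · simp [pairVec, h1, h2]
  rw [dotProduct, Finset.sum_congr rfl fun i _ => h i, ← Finset.mul_sum, Finset.sum_add_distrib]
  norm_num

/-- The eigenvalue `(3 + 4i) / 5`. -/
noncomputable def unitPhase : ℂ := 3 / 5 + 4 / 5 * Complex.I

lemma star_unitPhase : star unitPhase = 3 / 5 - 4 / 5 * Complex.I := by
  simp [unitPhase, Complex.ext_iff]

lemma unitPhase_mul_star : unitPhase * star unitPhase = 1 := by
  rw [star_unitPhase, unitPhase]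
  linear_combination (-16 / 25) * Complex.I_sq

/-- If `b` is the partner of `a`, then `Ω x̄` also lies in the plane of `e_a` and `e_b` and
contributes; otherwise it does not meet that plane. The chosen phase keeps the coefficients nonzero
in both cases; the phase `i` would kill `t + t̄`. -/
lemma exists_symplRot_pairVec_col (hd : Even d) {a b : Fin d} (hab : a ≠ b) :
    ∃ c₁ c₂ : ℂ, c₁ ≠ 0 ∧ c₂ ≠ 0 ∧ ∀ s : ℂ, s * star s = 1 → ∀ i,
      symplRot (pairVec a b s) unitPhase i a =
        c₁ * (if i = a then 1 else 0) + c₂ * s * (if i = b then 1 else 0) := by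
  have hr := ofReal_inv_sqrt_two_mul_self
  by_cases hb : b = partner a
  · subst hb
    refine ⟨(unitPhase + star unitPhase) / 2, (unitPhase - star unitPhase) / 2, ?_, ?_, ?_⟩
    · rw [star_unitPhase, unitPhase]; norm_num [Complex.ext_iff]
    · rw [star_unitPhase, unitPhase]; norm_num [Complex.ext_iff]
    · intro s hs i
      have h1 : (if partner i = a then (1 : ℂ) else 0) = if i = partner a then 1 else 0 := by
        simp only [partner_eq_iff hd]
      have h2 : sgn i * sgn a * (if i = a then (1 : ℂ) else 0) = if i = a then 1 else 0 := by
        split_ifs with h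
        · rw [h, sgn_mul_self, one_mul]
        · simp
      have h3 : sgn i * sgn a * (if i = partner a then (1 : ℂ) else 0) =
          -if i = partner a then 1 else 0 := by
        split_ifs with h
        · rw [h, sgn_partner hd]
          linear_combination -sgn_mul_self a
        · simp
      rw [symplRot_apply hd]
      simp only [pairVec, hab, partner_inj hd, hab.symm, if_true, if_false, star_mul', star_add,
        Complex.star_def, Complex.conj_ofReal, apply_ite (starRingEnd ℂ), map_one, map_zero, h1]
      simp only [← Complex.star_def]
      generalize (((√2)⁻¹ : ℝ) : ℂ) = r at *
      generalize unitPhase = t at *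
      generalize (if i = a then (1 : ℂ) else 0) = A at *
      generalize (if i = partner a then (1 : ℂ) else 0) = B at *
      linear_combination ((t - 1) * (A + s * B) +
          (star t - 1) * s * (sgn i * sgn a) * (B + star s * A)) * hr
        + ((star t - 1) / 2 * s) * h3 + ((star t - 1) / 2 * s * star s) * h2
        + ((star t - 1) / 2 * A) * hs
  · refine ⟨(unitPhase + 1) / 2, (unitPhase - 1) / 2, ?_, ?_, ?_⟩
    · rw [unitPhase]; norm_num [Complex.ext_iff]
    · rw [unitPhase]; norm_num [Complex.ext_iff]
    · intro s hs i
      rw [symplRot_apply hd]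
      simp only [pairVec, hab, partner_ne hd a, Ne.symm hb, if_true, if_false, star_mul', star_add,
        Complex.star_def, Complex.conj_ofReal, map_one, map_zero]
      linear_combination ((unitPhase - 1) *
        ((if i = a then 1 else 0) + s * (if i = b then 1 else 0))) * hr

lemma conj_single_apply (S : Mat d) (a i j : Fin d) :
    (S * single a a (1 : ℂ) * Sᴴ) i j = S i a * star (S j a) := by
  simp [mul_apply, single_apply, ite_and]

/-- A subspace invariant under the symplectic group which contains a diagonal matrix unit is
everything. -/
lemma single_mem_of_invariant (hd : Even d) (K : Submodule ℂ (Mat d))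
    (hK : ∀ S ∈ Sp d, ∀ Z ∈ K, S * Z * Sᴴ ∈ K) {a b : Fin d} (hab : a ≠ b)
    (ha : single a a (1 : ℂ) ∈ K) : single b b (1 : ℂ) ∈ K ∧ single a b (1 : ℂ) ∈ K := by
  obtain ⟨c₁, c₂, h₁, h₂, hc⟩ := exists_symplRot_pairVec_col hd hab
  have key : ∀ s : ℂ, s * star s = 1 → (c₂ * star c₂) • single b b (1 : ℂ) +
      (c₁ * star c₂ * star s) • single a b (1 : ℂ) +
      (c₂ * star c₁ * s) • single b a (1 : ℂ) ∈ K := by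
    intro s hs
    have h := hK _ (symplRot_mem_Sp hd (pairVec_dotProduct hab hs) unitPhase_mul_star) _ ha
    have h' := K.sub_mem h (K.smul_mem (c₁ * star c₁) ha)
    convert h' using 1
    ext i j
    simp only [Matrix.sub_apply, conj_single_apply, hc s hs, Matrix.add_apply, Matrix.smul_apply,
      single_apply, smul_eq_mul, star_add, star_mul', apply_ite (star : ℂ → ℂ), star_one,
      star_zero, ite_and, eq_comm (a := a), eq_comm (a := b)]
    have hm : ∀ (P Q : Prop) [Decidable P] [Decidable Q], (if P then if Q then (1 : ℂ) else 0 else 0)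
        = (if P then 1 else 0) * (if Q then 1 else 0) := by
      intro P Q _ _; split_ifs <;> simp
    simp only [hm]
    linear_combination (-(c₂ * star c₂ * (if i = b then 1 else 0) * (if j = b then 1 else 0))) * hs
  -- Adding `s = 1` and `s = -1` isolates `E_bb`; adding `s = 1` to `i` times `s = i` doubles the
  -- `E_ab` term and cancels the `E_ba` term.
  have k1 := key 1 (by simp)
  have k2 := key (-1) (by simp)
  have k3 := key Complex.I (by simp)
  have hα : c₁ * star c₂ ≠ 0 := mul_ne_zero h₁ (star_ne_zero.2 h₂)
  have hβ : c₂ * star c₂ ≠ 0 := mul_ne_zero h₂ (star_ne_zero.2 h₂)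
  have hb : single b b (1 : ℂ) ∈ K := by
    refine (K.smul_mem_iff (mul_ne_zero hβ two_ne_zero)).1 ?_
    convert K.add_mem k1 k2 using 1
    simp only [star_neg, star_one]
    match_scalars <;> ring
  refine ⟨hb, (K.smul_mem_iff (mul_ne_zero hα two_ne_zero)).1 ?_⟩
  convert K.sub_mem (K.add_mem k1 (K.smul_mem Complex.I k3))
    (K.smul_mem (c₂ * star c₂ * (1 + Complex.I)) hb) using 1
  simp only [star_one, Complex.star_def, Complex.conj_I]
  match_scalars
  · linear_combination (c₁ * (starRingEnd ℂ) c₂) * Complex.I_sq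
  · ring
  · linear_combination -(c₂ * (starRingEnd ℂ) c₁) * Complex.I_sq

/-- The kernel is an invariant subspace, so one diagonal matrix unit in it brings in all matrix
units. -/
lemma eq_zero_of_isSympCovariant (hd : Even d) {L : Mat d →ₗ[ℂ] Mat d} (hL : IsSympCovariant L)
    {a : Fin d} (ha : L (single a a 1) = 0) : L = 0 := by
  have hK : ∀ S ∈ Sp d, ∀ Z ∈ LinearMap.ker L, S * Z * Sᴴ ∈ LinearMap.ker L := by
    intro S hS Z hZ
    rw [LinearMap.mem_ker] at hZ ⊢
    rw [hL S hS, hZ]; simp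
  have hdiag : ∀ b : Fin d, single b b (1 : ℂ) ∈ LinearMap.ker L := by
    intro b
    by_cases hab : a = b
    · exact hab ▸ ha
    · exact (single_mem_of_invariant hd _ hK hab ha).1
  refine (Matrix.stdBasis ℂ (Fin d) (Fin d)).ext fun ⟨b, c⟩ => ?_
  rw [Matrix.stdBasis_eq_single]
  by_cases hbc : b = c
  · subst hbc; exact hdiag b
  · exact (single_mem_of_invariant hd _ hK hbc (hdiag b)).2

/-- If `e_a` is an eigenvector of `S`, conjugation by `S` fixes `E_aa`, hence also its image. -/
lemma commute_of_isSympCovariant {L : Mat d →ₗ[ℂ] Mat d} (hL : IsSympCovariant L)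
    {a : Fin d} {S : Mat d} (hS : S ∈ Sp d) {c : ℂ} (hc : c * star c = 1)
    (h : ∀ i, S i a = if i = a then c else 0) :
    S * L (single a a 1) = L (single a a 1) * S := by
  have e : S * single a a (1 : ℂ) * Sᴴ = single a a (1 : ℂ) := by
    ext i j
    rw [conj_single_apply, h, h, single_apply]
    simp only [eq_comm (a := a)]
    by_cases hi : i = a <;> by_cases hj : j = a <;> simp [hi, hj]
    exact hc
  have h1 : Sᴴ * S = 1 := mem_unitaryGroup_iff'.1 hS.1
  have := hL S hS (single a a 1)
  rw [e] at this
  conv_rhs => rw [this, Matrix.mul_assoc, h1, Matrix.mul_one]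

/-- The diagonal symplectic unitary with entries `i` at `j`, `-i` at its partner and `1` elsewhere
commutes with the image and separates `j` from every other index. -/
lemma offDiag_of_isSympCovariant (hd : Even d) {L : Mat d →ₗ[ℂ] Mat d} (hL : IsSympCovariant L)
    (a : Fin d) {j k : Fin d} (hjk : j ≠ k) : L (single a a 1) j k = 0 := by
  set x : Fin d → ℂ := Pi.single j 1 with hx
  have hxx : star x ⬝ᵥ x = 1 := by simp [hx]
  have ht : Complex.I * star Complex.I = 1 := by simp
  set S := symplRot x Complex.I with hS
  have happ : ∀ i l, S i l = if i = l then (1 + (Complex.I - 1) * (if i = j then 1 else 0)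
      + (star Complex.I - 1) * (if partner i = j then 1 else 0)) else 0 := by
    intro i l
    rw [hS, symplRot_apply hd]
    have hs := sgn_mul_self i
    by_cases hil : i = l
    · subst hil
      by_cases h1 : i = j <;> by_cases h2 : partner i = j <;> 
        simp [hx, h1, h2, hs, partner_ne hd j]
    · have h1 : (Pi.single j 1 : Fin d → ℂ) i * star ((Pi.single j 1 : Fin d → ℂ) l) = 0 := by
        by_cases h : i = j
        · have : l ≠ j := fun h' => hil (h.trans h'.symm)
          simp [this]
        · simp [h]
      have h2 : star ((Pi.single j 1 : Fin d → ℂ) (partner i)) *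
          (Pi.single j 1 : Fin d → ℂ) (partner l) = 0 := by
        by_cases h : partner i = j
        · have : partner l ≠ j := fun h' => hil ((partner_inj hd).1 (h.trans h'.symm))
          simp [this]
        · simp [h]
      rw [hx, h1, mul_assoc (sgn i * sgn l), h2]
      simp [hil]
  have hjj : S j j = Complex.I := by simp [happ, partner_ne hd]
  have hkk : S k k ≠ Complex.I := by
    rw [happ]
    by_cases h : partner k = j <;> simp [hjk.symm, h, Complex.ext_iff]
    norm_num
  have hcc : S a a * star (S a a) = 1 := by
    rw [happ]
    by_cases h1 : a = j
    · simp [h1, partner_ne hd]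
    · by_cases h2 : partner a = j <;> simp [h1, h2]
  have hcomm := commute_of_isSympCovariant hL (a := a) (symplRot_mem_Sp hd hxx ht) hcc
    (fun i => by
      by_cases h : i = a
      · simp [h, hS]
      · rw [← hS, happ]; simp [h])
  have h := congrFun (congrFun hcomm j) k
  rw [← hS, mul_apply, mul_apply,
    Finset.sum_eq_single j (fun l _ hl => by rw [happ, if_neg hl.symm, zero_mul]) (by simp),
    Finset.sum_eq_single k (fun l _ hl => by rw [happ, if_neg hl, mul_zero]) (by simp), hjj] at h
  have : (Complex.I - S k k) * L (single a a 1) j k = 0 := by linear_combination h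
  exact (mul_eq_zero.1 this).resolve_left (sub_ne_zero.2 hkk.symm)

/-- A rotation along `(e_j + e_k)/√2` fixes `e_a` and has a nonzero `(k, j)` entry; commuting with
the diagonal image equates the two diagonal entries. -/
lemma diag_eq_of_isSympCovariant (hd : Even d) {L : Mat d →ₗ[ℂ] Mat d} (hL : IsSympCovariant L)
    {a j k : Fin d} (hja : j ≠ a) (hja' : j ≠ partner a) (hka : k ≠ a) (hka' : k ≠ partner a) :
    L (single a a 1) j j = L (single a a 1) k k := by
  by_cases hjk : j = k
  · rw [hjk]
  obtain ⟨c₁, c₂, -, h₂, hc⟩ := exists_symplRot_pairVec_col hd hjk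
  have hc' := hc 1 (by simp)
  have hcomm := commute_of_isSympCovariant hL (a := a) (c := 1)
    (symplRot_mem_Sp hd (pairVec_dotProduct hjk (s := 1) (by simp)) unitPhase_mul_star) (by simp)
    (fun i => by
      rw [symplRot_apply hd]
      have h1 : pairVec j k 1 a = 0 := by simp [pairVec, hja.symm, hka.symm]
      have h2 : pairVec j k 1 (partner a) = 0 := by simp [pairVec, hja'.symm, hka'.symm]
      simp [h1, h2])
  set S := symplRot (pairVec j k 1) unitPhase
  have h := congrFun (congrFun hcomm k) j
  rw [mul_apply, mul_apply,
    Finset.sum_eq_single j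
      (fun l _ hl => by rw [offDiag_of_isSympCovariant hd hL a hl, mul_zero]) (by simp),
    Finset.sum_eq_single k
      (fun l _ hl => by rw [offDiag_of_isSympCovariant hd hL a hl.symm, zero_mul]) (by simp),
    hc', if_neg (Ne.symm hjk), if_pos rfl] at h
  exact mul_left_cancel₀ h₂ (by linear_combination h)

/-- Every covariant map is a combination of the trace, the identity and the symplectic
transposition; its coefficients are read off from the image of a diagonal matrix unit. -/
theorem eq_covMap_of_isSympCovariant (hd : Even d) {L : Mat d →ₗ[ℂ] Mat d}
    (hL : IsSympCovariant L) {a b : Fin d} (hba : b ≠ a) (hba' : b ≠ partner a) :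
    L = covMap d (L (single a a 1) b b) (L (single a a 1) a a - L (single a a 1) b b)
      (L (single a a 1) (partner a) (partner a) - L (single a a 1) b b) := by
  rw [← sub_eq_zero]
  -- The difference of the two sides is covariant, so it only has to vanish at `E_aa`.
  refine eq_zero_of_isSympCovariant hd (a := a) (fun S hS Z => ?_) ?_
  · rw [LinearMap.sub_apply, LinearMap.sub_apply, hL S hS, isSympCovariant_covMap hd _ _ _ S hS,
      Matrix.mul_sub, Matrix.sub_mul]
  · rw [LinearMap.sub_apply, sub_eq_zero]
    ext i j
    rw [covMap_single_apply hd]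
    by_cases hij : i = j
    · subst hij
      simp only [if_true, sgn_mul_self, ← partner_eq_iff hd, one_mul]
      by_cases h1 : i = a
      · subst h1
        simp [partner_ne hd]
      · by_cases h2 : i = partner a
        · subst h2
          simp [(partner_ne hd a).symm]
        · simp [Ne.symm h1, Ne.symm h2, diag_eq_of_isSympCovariant hd hL h1 h2 hba hba']
    · rw [offDiag_of_isSympCovariant hd hL a hij]
      have h1 : ¬(a = i ∧ a = j) := fun h => hij (h.1.symm.trans h.2)
      have h2 : ¬(a = partner j ∧ a = partner i) := fun h =>
        hij ((partner_inj hd).1 (h.2.symm.trans h.1))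
      simp [← ite_and, hij, h1, h2]

lemma IsKPositive.diag_nonneg {k : ℕ} (hk : 0 < k) {L : Mat d →ₗ[ℂ] Mat d}
    (hL : IsKPositive k L) (a i : Fin d) : 0 ≤ L (single a a 1) i i := by
  have h := (hL _ (posSemidef_vecMulVec_self_star
    (Pi.single ((⟨0, hk⟩ : Fin k), a) (1 : ℂ)))).diag_nonneg (i := (⟨0, hk⟩, i))
  convert h using 1
  refine congrArg (fun Z : Mat d => L Z i i) ?_
  ext x y
  simp [vecMulVec_apply, Pi.single_apply, single_apply, ← ite_and, eq_comm, and_comm]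

/-- Every `d / 2`-positive covariant map is decomposable. -/
theorem isDecomposable_of_isSympCovariant (hd : Even d) (h4 : 4 ≤ d) {L : Mat d →ₗ[ℂ] Mat d}
    (hL : IsSympCovariant L) (hk : IsKPositive (d / 2) L) : IsDecomposable L := by
  have hk0 : 0 < d / 2 := by omega
  let a : Fin d := ⟨0, by omega⟩
  let b : Fin d := ⟨1, by omega⟩
  have hba : b ≠ a := by simp [a, b]
  have hba' : b ≠ partner a := by
    have := partner_val_of_lt hd a hk0
    intro e
    rw [← e] at this
    simp only [a, b] at this
    omega
  -- Positivity makes these entries real, so the criteria for real coefficients apply.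
  have hr : ∀ i, ∃ r : ℝ, L (single a a 1) i i = r := fun i =>
    ⟨_, (Complex.eq_re_of_ofReal_le (hk.diag_nonneg hk0 a i))⟩
  obtain ⟨r₁, h₁⟩ := hr a
  obtain ⟨r₂, h₂⟩ := hr (partner a)
  obtain ⟨r₃, h₃⟩ := hr b
  have e := eq_covMap_of_isSympCovariant hd hL hba hba'
  rw [h₁, h₂, h₃, ← Complex.ofReal_sub, ← Complex.ofReal_sub] at e
  rw [e] at hk ⊢
  obtain ⟨i1, i2, i3⟩ := hk.nonneg_of_covMap hd h4 hk0
  exact isDecomposable_covMap hd h4 i1 i2 i3 (hk.add_nonneg_of_covMap hd (by omega))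

/-! ### The regions in the parameter plane. -/

lemma mem_decRegion_iff (h4 : 4 ≤ d) (p q : ℝ) :
    (p, q) ∈ decRegion d ↔ 0 ≤ (1 - p - q) / d ∧ 0 ≤ (1 - p - q) / d + p ∧
      0 ≤ (1 - p - q) / d + q ∧ 0 ≤ p + q + (1 - p - q) / d * (1 + 2 / d) := by
  have hd : (4 : ℝ) ≤ d := by exact_mod_cast h4
  have h0 : (0 : ℝ) < d := by linarith
  have hD : 0 < (d : ℝ) ^ 2 - d - 2 := by nlinarith
  have e1 : 0 ≤ (1 - p - q) / d ↔ p + q ≤ 1 := by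
    rw [le_div_iff₀ h0, zero_mul]; constructor <;> intro h <;> linarith
  have e2 : 0 ≤ (1 - p - q) / d + p ↔ (1 - (d : ℝ)) * p + q ≤ 1 := by
    rw [show (1 - p - q) / d + p = (1 - p - q + d * p) / d by field_simp,
      le_div_iff₀ h0, zero_mul]; constructor <;> intro h <;> linarith
  have e3 : 0 ≤ (1 - p - q) / d + q ↔ p + (1 - (d : ℝ)) * q ≤ 1 := by
    rw [show (1 - p - q) / d + q = (1 - p - q + d * q) / d by field_simp,
      le_div_iff₀ h0, zero_mul]; constructor <;> intro h <;> linarith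
  have e4 : 0 ≤ p + q + (1 - p - q) / d * (1 + 2 / d) ↔
      -((2 + (d : ℝ)) / ((d : ℝ) ^ 2 - d - 2)) ≤ p + q := by
    rw [show p + q + (1 - p - q) / d * (1 + 2 / d) =
        ((p + q) * ((d : ℝ) ^ 2 - d - 2) + (2 + d)) / d ^ 2 by field_simp; ring,
      le_div_iff₀ (by positivity), zero_mul, ← neg_div, div_le_iff₀ hD]
    constructor <;> intro h <;> linarith
  rw [e1, e2, e3, e4]
  exact ⟨fun ⟨a, b, c, d⟩ => ⟨b, d, c, a⟩, fun ⟨b, d, c, a⟩ => ⟨a, b, c, d⟩⟩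

theorem mem_decRegion_iff_isDecomposable (hd : Even d) (h4 : 4 ≤ d) (p q : ℝ) :
    (p, q) ∈ decRegion d ↔ IsDecomposable (sympMap d p q) := by
  rw [mem_decRegion_iff h4, sympMap_eq_covMap]
  refine ⟨fun ⟨a, b, c, e⟩ => isDecomposable_covMap hd h4 a b c e, fun h => ?_⟩
  obtain ⟨a, b, c⟩ := h.isKPositive_one.nonneg_of_covMap hd h4 one_pos
  exact ⟨a, b, c, h.add_nonneg_of_covMap hd (by omega)⟩

theorem kPosRegion_half_subset (hd : Even d) (h4 : 4 ≤ d) :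
    kPosRegion d (d / 2) ⊆ decRegion d := by
  rintro ⟨p, q⟩ h
  rw [kPosRegion, Set.mem_ofPred_eq, sympMap_eq_covMap] at h
  obtain ⟨a, b, c⟩ := h.nonneg_of_covMap hd h4 (by omega)
  exact (mem_decRegion_iff h4 p q).2 ⟨a, b, c, h.add_nonneg_of_covMap hd (by omega)⟩

lemma natCast_half_sub_one (hd : Even d) (h4 : 4 ≤ d) :
    ((d / 2 - 1 : ℕ) : ℝ) = (d : ℝ) / 2 - 1 := by
  obtain ⟨m, rfl⟩ := hd
  rw [show (m + m) / 2 - 1 = m - 1 by omega, Nat.cast_sub (by omega)]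
  push_cast
  ring

theorem isKPositive_of_mem_indecTriangle (hd : Even d) (h4 : 4 ≤ d) {p q : ℝ}
    (h : (p, q) ∈ indecTriangle d) {k : ℕ} (hk : k ≤ d / 2 - 1) :
    IsKPositive k (sympMap d p q) := by
  obtain ⟨h1, h2, h3⟩ := h
  simp only at h1 h2 h3
  have hd' : (4 : ℝ) ≤ d := by exact_mod_cast h4
  have h0 : (0 : ℝ) < d := by linarith
  have hD : 0 < (d : ℝ) ^ 2 - d - 2 := by nlinarith
  rw [← neg_div, lt_div_iff₀ hD] at h1
  rw [sympMap_eq_covMap]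
  refine isKPositive_covMap hd (n := d / 2 - 1) (by omega) hk ?_ ?_ ?_
  -- If `q > 0`, the third inequality gives `c (p + q) > -1`; but `c ≥ d - 1` and the bound on `p +
  -- q` give `c (p + q) < -(d-1)(d+2)/((d-2)(d+1)) < -1`.
  · by_contra! hq
    set c : ℝ := ((d : ℝ) / 2 - 1) * d - 1 with hc
    have hc1 : (d : ℝ) - 1 ≤ c := by rw [hc]; nlinarith
    have hc0 : 0 < c := by linarith
    have e1 : (1 + c) * q - 1 ≤ c * (p + q) := by
      have : c * p = ((d : ℝ) / 2 - 1) * d * p - p := by rw [hc]; ring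
      linarith
    have e2 := mul_lt_mul_of_pos_left h1 hc0
    have e3 := mul_le_mul_of_nonneg_right e1 hD.le
    have e4 : ((d : ℝ) - 1) * (2 + d) ≤ c * (2 + d) :=
      mul_le_mul_of_nonneg_right hc1 (by linarith)
    have e5 : 0 < (1 + c) * q * ((d : ℝ) ^ 2 - d - 2) := by positivity
    nlinarith
  · rw [show (1 - p - q) / d + q = (1 - p - q + d * q) / d by field_simp]
    exact div_nonneg (by linarith) h0.le
  · rw [natCast_half_sub_one hd h4, show (1 - p - q) / d + ((d : ℝ) / 2 - 1) * p =
      (1 - p - q + d * (((d : ℝ) / 2 - 1) * p)) / d by field_simp]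
    exact div_nonneg (by linarith) h0.le

theorem kPosRegion_diff_decRegion (hd : Even d) (h4 : 4 ≤ d) :
    kPosRegion d (d / 2 - 1) \ decRegion d = indecTriangle d := by
  have hd' : (4 : ℝ) ≤ d := by exact_mod_cast h4
  have h0 : (0 : ℝ) < d := by linarith
  ext ⟨p, q⟩
  constructor
  · rintro ⟨h, hn⟩
    rw [kPosRegion, Set.mem_ofPred_eq, sympMap_eq_covMap] at h
    obtain ⟨h1, h2, h3⟩ := h.nonneg_of_covMap hd h4 (by omega)
    have h5 := h.add_mul_nonneg_of_covMap hd (by omega) (by omega)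
    rw [natCast_half_sub_one hd h4] at h5
    have e1 : d * ((1 - p - q) / d + p) = 1 - p - q + d * p := by field_simp
    have e2 : d * ((1 - p - q) / d + q) = 1 - p - q + d * q := by field_simp
    have e3 : d * ((1 - p - q) / d) = 1 - p - q := by field_simp
    have e4 : d * ((1 - p - q) / d + ((d : ℝ) / 2 - 1) * p) =
      1 - p - q + d * (((d : ℝ) / 2 - 1) * p) := by field_simp
    have f1 := mul_nonneg h0.le h2
    have f2 := mul_nonneg h0.le h3
    have f3 := mul_nonneg h0.le h1
    have f4 := mul_nonneg h0.le h5
    rw [e1] at f1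
    rw [e2] at f2
    rw [e3] at f3
    rw [e4] at f4
    refine ⟨?_, ?_, ?_⟩
    -- Positivity already gives the other three sides of the quadrilateral, so only this one can
    -- fail.
    · by_contra! hc
      exact hn ⟨hc, by simp only; linarith, by simp only; linarith, by simp only; linarith⟩
    · simp only; linarith
    · simp only; linarith
  · exact fun h => ⟨isKPositive_of_mem_indecTriangle hd h4 h le_rfl, fun h' => h.1.not_ge h'.1⟩

/-- The point is the vertex of the triangle at which both non-strict inequalities are equalities. -/
lemma pointP_mem_indecTriangle (h4 : 4 ≤ d) : pointP d ∈ indecTriangle d := by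
  have hd : (4 : ℝ) ≤ d := by exact_mod_cast h4
  have hE : 0 < (d : ℝ) ^ 2 - 3 * d := by nlinarith
  have hD : 0 < (d : ℝ) ^ 2 - d - 2 := by nlinarith
  have h3 : (d : ℝ) - 3 ≠ 0 := by linarith
  refine ⟨?_, ?_, ?_⟩
  · simp only [pointP]
    rw [← neg_add, neg_lt_neg_iff, ← add_div, div_lt_div_iff₀ hD hE]
    nlinarith
  · simp only [pointP]
    apply le_of_eq
    field_simp
    ring
  · simp only [pointP]
    apply le_of_eq
    field_simp
    ring

lemma sympMap_pointP_apply (h4 : 4 ≤ d) (Z : Mat d) :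
    sympMap d (pointP d).1 (pointP d).2 Z = (1 / ((d : ℂ) ^ 2 - 3 * d)) •
      ((((d : ℂ) - 2) * Z.trace) • (1 : Mat d) - (2 : ℂ) • Z
        - ((d : ℂ) - 2) • (Omega d * Z.transpose * (Omega d).conjTranspose)) := by
  have hd : (4 : ℝ) ≤ d := by exact_mod_cast h4
  have h3' : (d : ℝ) - 3 ≠ 0 := by linarith
  have h3 : (d : ℂ) - 3 ≠ 0 := by exact_mod_cast h3'
  have h0 : (d : ℂ) ≠ 0 := by
    have : d ≠ 0 := by omega
    exact_mod_cast this
  simp only [sympMap, LinearMap.coe_mk, AddHom.coe_mk, pointP]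
  push_cast
  match_scalars <;> field_simp
  ring

end SympMaps

/-! ### Assembly; the point `P` serves as witness for every `k` at once. -/

theorem mainTheorem3 (d : ℕ) (hd : Even d) (hd4 : 4 ≤ d) :
    -- the maps of the family are `(S,S)`-covariant
    (∀ p q : ℝ, SympMaps.IsSympCovariant (SympMaps.sympMap d p q)) ∧
    -- `D` is the decomposability region
    (∀ p q : ℝ, (p, q) ∈ SympMaps.decRegion d ↔
      SympMaps.IsDecomposable (SympMaps.sympMap d p q)) ∧
    -- `k`-positive indecomposable maps exist in the family for `1 ≤ k ≤ d/2 - 1`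
    (∀ k : ℕ, 1 ≤ k → k ≤ d / 2 - 1 →
      (SympMaps.kPosRegion d k \ SympMaps.decRegion d).Nonempty) ∧
    -- `P_{d/2} ⊆ D`
    SympMaps.kPosRegion d (d / 2) ⊆ SympMaps.decRegion d ∧
    -- the `(d/2-1)`-positive indecomposable region
    SympMaps.kPosRegion d (d / 2 - 1) \ SympMaps.decRegion d = SympMaps.indecTriangle d ∧
    -- the maps with parameters in this region are `(d/2-1)`-positive and indecomposable,
    -- and conversely
    (∀ p q : ℝ,
      (SympMaps.IsKPositive (d / 2 - 1) (SympMaps.sympMap d p q) ∧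
        ¬ SympMaps.IsDecomposable (SympMaps.sympMap d p q)) ↔
      (p, q) ∈ SympMaps.indecTriangle d) ∧
    -- the explicit map `L_P`
    (∀ Z : SympMaps.Mat d,
      SympMaps.sympMap d (SympMaps.pointP d).1 (SympMaps.pointP d).2 Z =
        (1 / ((d : ℂ) ^ 2 - 3 * d)) •
          ((((d : ℂ) - 2) * Z.trace) • (1 : SympMaps.Mat d) - (2 : ℂ) • Z
            - ((d : ℂ) - 2) • (SympMaps.Omega d * Z.transpose *
                (SympMaps.Omega d).conjTranspose))) ∧
    (∀ k : ℕ, 1 ≤ k → k ≤ d / 2 - 1 →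
      SympMaps.IsKPositive k
        (SympMaps.sympMap d (SympMaps.pointP d).1 (SympMaps.pointP d).2)) ∧
    ¬ SympMaps.IsDecomposable
        (SympMaps.sympMap d (SympMaps.pointP d).1 (SympMaps.pointP d).2) ∧
    -- every `d/2`-positive `(S,S)`-covariant linear map is decomposable
    (∀ L : SympMaps.Mat d →ₗ[ℂ] SympMaps.Mat d, SympMaps.IsSympCovariant L →
      SympMaps.IsKPositive (d / 2) L → SympMaps.IsDecomposable L) := by
  have htri := SympMaps.kPosRegion_diff_decRegion hd hd4
  have hP := SympMaps.pointP_mem_indecTriangle hd4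
  have hPk : ∀ k : ℕ, 1 ≤ k → k ≤ d / 2 - 1 → SympMaps.IsKPositive k
      (SympMaps.sympMap d (SympMaps.pointP d).1 (SympMaps.pointP d).2) :=
    fun k _ hk => SympMaps.isKPositive_of_mem_indecTriangle hd hd4 hP hk
  have hPD : SympMaps.pointP d ∉ SympMaps.decRegion d := (htri.symm ▸ hP).2
  refine ⟨fun p q => ?_, SympMaps.mem_decRegion_iff_isDecomposable hd hd4,
    fun k h1 hk => ⟨_, hPk k h1 hk, hPD⟩, SympMaps.kPosRegion_half_subset hd hd4, htri,
    fun p q => ?_, SympMaps.sympMap_pointP_apply hd4, hPk,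
    fun h => hPD ((SympMaps.mem_decRegion_iff_isDecomposable hd hd4 _ _).2 h),
    fun L hL hk => SympMaps.isDecomposable_of_isSympCovariant hd hd4 hL hk⟩
  · rw [SympMaps.sympMap_eq_covMap]
    exact SympMaps.isSympCovariant_covMap hd _ _ _
  · rw [← htri, ← SympMaps.mem_decRegion_iff_isDecomposable hd hd4]
    rfl
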